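/- Let $G=(V,E)$ be the complete graph on a finite set $V$, let $d:E\to\mathbb R_{\ge 0}$ be a metric (distances $0$ between distinct vertices are allowed) and let $\mathfrak T\subseteq V\times V$ be a set of terminal pairs. The vertices occurring in pairs are the terminals. An edge set $H\subseteq E$ is feasible if each pair of $\mathfrak T$ lies in one connected component of $(V,H)$. Write $d(H)=\sum_{e\in H}d_e$. The width of a component is the largest distance of a terminal pair lying in it ($0$ if there is none), $w(H)$ is the sum of the widths of the components of $(V,H)$, and $\phi(H)=d(H)+w(H)$. Let $A$ be a feasible forest, and let $u\ne v$ be vertices of one component of $A$, joined by the path $p$ in $A$. Consider moves that add a new edge $e=uv$ (possibly parallel to an edge of $A$, which is then all of $p$). * Edge/edge swap $(e,f)$: add $e$ and remove an edge $f$ of $p$. * For $f\in p$ let $R(e,f)$ consist of $f$ and of all edges $g$ of $p$ such that $(A\setminus\{f,g\})\cup\{e\}$ is feasible. Edge/set swap $(e,S)$: add $e$ and remove a non-empty set $S$ that, for some $f \in p$, consists of edges of $R(e,f)$ that are consecutive in the order in which $R(e,f)$ appears on $p$, provided that $(A\setminus S)\cup\{e\}$ is feasible. * Path/set swap $(u,v,S)$: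 here $(e,S)$ is as in an edge/set swap, but instead of $e$ one adds the edges of a shortest $u$–$v$ path in the graph that arises from $G$ by shrinking every component of $A$ other than the component $T$ of $u$ and $v$ to a single point and removing all vertices of $T$ other than $u,v$. A swap is improving if it decreases $\phi$. For $B\subseteq E$ and lengths $\ell:B\to\mathbb R_{\ge0}$, $A$ is edge/edge (edge/set) swap-optimal with respect to $(B,\ell)$ and $\phi$ if no edge/edge (edge/set) swap that adds an edge $e\in B$ is improving, where the added edge $e$ contributes $\ell(e)$ to the total length and edges of $A$ contribute their $d$-length. Swap-optimality with respect to $E$ means with respect to $(E,d)$. $A$ is path/set swap-optimal if no path/set swap is improving. For $c\ge1$, $A$ is $c$-approximate connecting move optimal if there is no tree $K$ with at least one edge in the multigraph obtained from $G$ by contracting all components of $A$, deleting loops and keeping parallel edges, such that $c\cdot d(K)\le w(A)-w(A\cup K)$. **Lemma.** Let $c\ge 1$, let $A\subseteq E$ be a feasible forest that only uses edges between terminals, and let $F\subseteq E$ be feasible. Suppose that $A$ is edge/edge, edge/set and path/set swap-optimal with respect to $E$ and $\phi$, and that $A$ is $c$-approximate connecting move optimal. Then there are a forest $F'\subseteq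 E$ and edge lengths $\ell$ with $0\le\ell(e)\le d_e$ for all $e\in E$ such that $F'$ is feasible, $\ell(F')=\sum_{e\in F'}\ell(e)\le 2(1+c)\cdot d(F)$, every edge of $F'$ has both ends in the same connected component of $A$, and $A$ is edge/edge and edge/set swap-optimal with respect to $(F',\ell)$ and $\phi$. -/

import Mathlib

/-!
Steiner forest local search on the complete graph over a finite (pseudo)metric space `V`.
An edge set of the complete graph is the same thing as a `SimpleGraph V`, so solutions are simple
graphs. The terminal pairs are a finite set `P` of pairs of vertices.
-/

namespace SteinerForest

open scoped NNReal

variable {V : Type*} [Fintype V] [PseudoMetricSpace V]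

/-- The metric, read as a length function on the edges of the complete graph. -/
noncomputable def edgeLength : Sym2 V → ℝ :=
  Sym2.lift ⟨fun x y => dist x y, dist_comm⟩

open scoped Classical in
/-- Total length of the edges of `H` with respect to the edge lengths `len`. -/
noncomputable def cost (len : Sym2 V → ℝ) (H : SimpleGraph V) : ℝ :=
  ∑ e ∈ (Finset.univ : Finset (Sym2 V)) with e ∈ H.edgeSet, len e

/-- `H` is a feasible solution: it connects every terminal pair. -/
def Feasible {V : Type*} (P : Finset (V × V)) (H : SimpleGraph V) : Prop :=
  ∀ p ∈ P, H.Reachable p.1 p.2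

/-- `v` is a terminal: it belongs to some terminal pair. -/
def IsTerminal {V : Type*} (P : Finset (V × V)) (v : V) : Prop :=
  ∃ p ∈ P, v = p.1 ∨ v = p.2

open scoped Classical in
/-- Width of a connected component `C`: the maximum distance of a terminal pair whose two vertices
lie in `C` (and `0` if there is no such pair). -/
noncomputable def width (P : Finset (V × V)) {H : SimpleGraph V} (C : H.ConnectedComponent) : ℝ≥0 :=
  (P.filter fun p => p.1 ∈ C.supp ∧ p.2 ∈ C.supp).sup fun p => nndist p.1 p.2

open scoped Classical in
/-- Total width of `H`: the sum of the widths of its connected components. (Components without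
edges are included; their width is `0`.) -/
noncomputable def totalWidth (P : Finset (V × V)) (H : SimpleGraph V) : ℝ :=
  ∑ C : H.ConnectedComponent, (width P C : ℝ)

/-- The potential `φ`: total edge length plus total width. -/
noncomputable def potential (P : Finset (V × V)) (H : SimpleGraph V) : ℝ :=
  cost edgeLength H + totalWidth P H

/-! ### Edge/edge and edge/set swaps

A swap adds an edge `uv` that closes a cycle with the path `p` of the forest `A` from `u` to `v`,
and removes edges of `p`. The new edge may be given a length `L` that differs from the distance
of `u` and `v`, and it may be parallel to an edge `uv` of `A` (then that edge is all of `p`). -/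

/-- Value of the potential after removing the edges `S` of `A` and adding a new edge `uv` of
length `L`. -/
noncomputable def swapPotential (P : Finset (V × V)) (A : SimpleGraph V) (u v : V) (L : ℝ)
    (S : Set (Sym2 V)) : ℝ :=
  cost edgeLength (A.deleteEdges S) + L +
    totalWidth P (A.deleteEdges S ⊔ SimpleGraph.edge u v)

/-- Adding `uv` to the forest `A` closes a cycle that contains the edge `f` of `A`. -/
def IsEdgeEdgeSwap {V : Type*} (A : SimpleGraph V) (u v : V) (f : Sym2 V) : Prop :=
  ∃ p : A.Walk u v, p.IsPath ∧ f ∈ p.edges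

/-- `R(uv, f)`: the edge `f`, and all edges on the cycle closed by `uv` that can be removed from
`A + uv - f` without destroying feasibility. -/
def removable {V : Type*} (P : Finset (V × V)) (A : SimpleGraph V) {u v : V} (p : A.Walk u v)
    (f : Sym2 V) : Set (Sym2 V) :=
  {g | g ∈ p.edges ∧ (g = f ∨ Feasible P (A.deleteEdges {f, g} ⊔ SimpleGraph.edge u v))}

/-- `(uv, S)` is an edge/set swap: `S` is a nonempty set of edges of some `R(uv, f)` that are
consecutive in the order in which the edges of `R(uv, f)` appear on the cycle (that is, `S` consists
of the edges of `R(uv, f)` on some contiguous piece of the path `p`), and the resulting solution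
is feasible. -/
def IsEdgeSetSwap {V : Type*} (P : Finset (V × V)) (A : SimpleGraph V) (u v : V)
    (S : Set (Sym2 V)) : Prop :=
  ∃ p : A.Walk u v, p.IsPath ∧ ∃ f ∈ p.edges, ∃ piece : List (Sym2 V),
    piece <:+: p.edges ∧ S = {g | g ∈ removable P A p f ∧ g ∈ piece} ∧ S.Nonempty ∧
      Feasible P (A.deleteEdges S ⊔ SimpleGraph.edge u v)

/-- `A` is edge/edge swap-optimal with respect to the edges of `B` and `φ`, where an edge `e` of
`B`, when added, has length `len e`: no edge/edge swap that adds an edge of `B` is improving. -/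
def EdgeEdgeSwapOptimal (P : Finset (V × V)) (A B : SimpleGraph V) (len : Sym2 V → ℝ) : Prop :=
  ∀ u v : V, B.Adj u v → ∀ f : Sym2 V, IsEdgeEdgeSwap A u v f →
    potential P A ≤ swapPotential P A u v (len s(u, v)) {f}

/-- `A` is edge/set swap-optimal with respect to the edges of `B` and `φ`, where an edge `e` of
`B`, when added, has length `len e`: no edge/set swap that adds an edge of `B` is improving. -/
def EdgeSetSwapOptimal (P : Finset (V × V)) (A B : SimpleGraph V) (len : Sym2 V → ℝ) : Prop :=
  ∀ u v : V, B.Adj u v → ∀ S : Set (Sym2 V), IsEdgeSetSwap P A u v S →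
    potential P A ≤ swapPotential P A u v (len s(u, v)) S

/-! ### Path/set swaps -/

/-- `x` and `y` become the same point when all components of `A` other than the one of `u` are
shrunk to single points. -/
def Shrunk {V : Type*} (A : SimpleGraph V) (u x y : V) : Prop :=
  x = y ∨ (A.Reachable x y ∧ ¬ A.Reachable u x)

/-- `l` lists the edges (as ordered pairs, in the direction of travel) of a path from `u` to `v` in
the complete graph after shrinking all components of `A` other than the component `T` of `u` to
single points and removing all vertices of `T` other than `u` and `v`. -/
structure IsContractedPath {V : Type*} (A : SimpleGraph V) (u v : V) (l : List (V × V)) : Prop where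
  /-- every edge starts at the point where the previous one ended; the first one starts at `u` -/
  chain : List.IsChain (fun e e' : V × V => Shrunk A u e.2 e'.1) ((u, u) :: l)
  /-- the last edge ends at `v` -/
  last : (((u, u) :: l).getLast (List.cons_ne_nil _ _)).2 = v
  /-- the path visits no point twice -/
  simple : (((u, u) :: l).map Prod.snd).Pairwise (fun x y => ¬ Shrunk A u x y)
  /-- in the component of `u` and `v` only these two vertices are used, at the two ends -/
  avoid : ∀ e ∈ l, (A.Reachable u e.1 → e.1 = u) ∧ (A.Reachable u e.2 → e.2 = v)

/-- Length of a contracted path: only the listed edges count. -/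
noncomputable def contractedLength (l : List (V × V)) : ℝ :=
  (l.map fun e => dist e.1 e.2).sum

/-- `l` is a shortest `u`-`v` path in the contracted graph. -/
def IsShortestContractedPath (A : SimpleGraph V) (u v : V) (l : List (V × V)) : Prop :=
  IsContractedPath A u v l ∧
    ∀ l', IsContractedPath A u v l' → contractedLength l ≤ contractedLength l'

/-- The edge set of a contracted path. -/
def pathEdges {V : Type*} (l : List (V × V)) : SimpleGraph V :=
  SimpleGraph.fromEdgeSet {e | ∃ x ∈ l, e = s(x.1, x.2)}

/-- `A` is path/set swap-optimal: for two vertices `u ≠ v` of a component, adding a shortest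
contracted `u`-`v` path and removing a set `S` that an edge/set swap with a virtual edge `uv`
could remove is never improving. -/
def PathSetSwapOptimal (P : Finset (V × V)) (A : SimpleGraph V) : Prop :=
  ∀ u v : V, u ≠ v → ∀ S : Set (Sym2 V), IsEdgeSetSwap P A u v S →
    ∀ l, IsShortestContractedPath A u v l →
      potential P A ≤ potential P (A.deleteEdges S ⊔ pathEdges l)

/-! ### Connecting moves -/

/-- The edges of `K` form a tree, with at least one edge, in the multigraph obtained by contracting
all components of the forest `A` in the complete graph and deleting loops: the contraction of `K` is
acyclic (without loops and parallel edges) iff `A` and `K` are disjoint and `A ∪ K` is a forest, and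
it is connected iff the vertices touched by `K` lie in one component of `A ∪ K`. -/
structure IsContractedTree {V : Type*} (A K : SimpleGraph V) : Prop where
  nonempty : K ≠ ⊥
  disjoint : Disjoint A K
  acyclic : (A ⊔ K).IsAcyclic
  connected : ∀ x ∈ K.support, ∀ y ∈ K.support, (A ⊔ K).Reachable x y

/-- There is no `c`-approximate connecting move, that is, no tree `K` in the contracted multigraph
with `c * d(K) ≤ w(A) - w(A ∪ K)`. -/
def ApproxConnectingMoveOptimal (P : Finset (V × V)) (c : ℝ) (A : SimpleGraph V) : Prop :=
  ∀ K : SimpleGraph V, IsContractedTree A K →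
    ¬ c * cost edgeLength K ≤ totalWidth P A - totalWidth P (A ⊔ K)

end SteinerForest

/-!
The edges of `F'` lie inside the components of `A`, and an edge `uv` gets as its length the length
of a shortest contracted `u`-`v` path. Adding such a path instead of `uv` only merges further
components, which cannot increase the total width of a feasible solution (`totalWidth_anti`). So
path/set swap-optimality of `A` is at least as strong as edge/set swap-optimality with respect to
these lengths (`edgeSetSwapOptimal_contractedEdgeLength`), and edge/edge swaps are special
edge/set swaps. What remains is to find a cheap feasible `F'` for these lengths.

Each component of `F` has a closed tour of at most twice its length (`exists_tour`). A tour is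
processed as a sequence of stops. Rank the components of `A` by width. A segment of the tour is
guarded if it starts and ends in the same component `T` and all stops inside it belong to
components of smaller rank. A guarded segment with fewest stops is replaced by one edge between
its two ends in `T`, whose length is at most that of the segment. The stops inside the segment are
discharged: each of them costs at most the width of its component, which pays for joining one
separated terminal pair linked to the stop (`Linked.discharge`). If no guarded segment is left,
all stops are discharged, the last one for free. This is `Linked.exists_feasible`.

The discharged widths sum to at most `c` times the length of the segment, because there is no
connecting move. To see this, remove from a sequence without guarded segments a visit of a
component `C` of smallest rank. By induction the edges of the shorter sequence split into
connected pieces of the contracted multigraph that gain, in total, the widths of all visits but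
one. When the visit of `C` is put back, it subdivides an edge of one piece. If the piece does not
use `C` yet, then it gains the width of `C`. Otherwise a cycle arises, and one of the two new
edges can be split off as a piece that gains the width of `C` (`Chargeable.subdivide`,
`Unguarded.chargeable`). Each piece contains a tree of the contracted multigraph, so its gain is
at most `c` times its length (`Chargeable.le_edgesLength`). Altogether a tour of length `D` is
replaced by edges of length at most `(1 + c) * D`.
-/

namespace SteinerForest

open scoped NNReal

section

variable {V : Type*}

/-! ### Reachability -/

theorem reachable_of_forall_adj {G H : SimpleGraph V}
    (h : ∀ a b, G.Adj a b → H.Reachable a b) {x y : V} (hxy : G.Reachable x y) :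
    H.Reachable x y := by
  obtain ⟨p⟩ := hxy
  induction p with
  | nil => exact .rfl
  | cons hab _ ih => exact (h _ _ hab).trans ih

theorem edge_reachable (u v : V) : (SimpleGraph.edge u v).Reachable u v := by
  by_cases h : u = v
  · exact h ▸ .rfl
  · exact SimpleGraph.Adj.reachable (by simp [SimpleGraph.edge_adj, h])

theorem reachable_or_of_reachable_sup_edge {G : SimpleGraph V} {x y a b : V}
    (h : (G ⊔ SimpleGraph.edge x y).Reachable a b) :
    G.Reachable a b ∨ G.Reachable a x ∨ G.Reachable a y := by
  obtain ⟨p⟩ := h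
  induction p with
  | nil => exact .inl .rfl
  | @cons a c b hac _ ih =>
    rw [SimpleGraph.sup_adj, SimpleGraph.edge_adj] at hac
    rcases hac with hac | ⟨⟨rfl, rfl⟩ | ⟨rfl, rfl⟩, -⟩
    · exact ih.imp hac.reachable.trans (Or.imp hac.reachable.trans hac.reachable.trans)
    · exact .inr (.inl .rfl)
    · exact .inr (.inr .rfl)

/-! ### Cost -/

@[simp]
theorem edgeLength_mk {V : Type*} [PseudoMetricSpace V] (u v : V) :
    edgeLength s(u, v) = dist u v := rfl

theorem edgeLength_nonneg {V : Type*} [PseudoMetricSpace V] (e : Sym2 V) :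
    0 ≤ edgeLength e := by
  induction e with | _ u v => exact dist_nonneg

variable [Fintype V]

section cost

open scoped Classical in
theorem cost_eq_sum_ite (len : Sym2 V → ℝ) (H : SimpleGraph V) :
    cost len H = ∑ e : Sym2 V, if e ∈ H.edgeSet then len e else 0 := by
  rw [cost, Finset.sum_filter]

variable {len : Sym2 V → ℝ}

theorem cost_mono (hlen : ∀ e, 0 ≤ len e) {H H' : SimpleGraph V} (h : H ≤ H') :
    cost len H ≤ cost len H' := by
  classical
  refine Finset.sum_le_sum_of_subset_of_nonneg (fun e he => ?_) fun e _ _ => hlen e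
  simp only [Finset.mem_filter, Finset.mem_univ, true_and] at he ⊢
  exact SimpleGraph.edgeSet_mono h he

theorem cost_nonneg (hlen : ∀ e, 0 ≤ len e) (H : SimpleGraph V) : 0 ≤ cost len H :=
  Finset.sum_nonneg fun e _ => hlen e

theorem cost_bot : cost len (⊥ : SimpleGraph V) = 0 := by
  simp [cost]

theorem cost_sup_le (hlen : ∀ e, 0 ≤ len e) (H H' : SimpleGraph V) :
    cost len (H ⊔ H') ≤ cost len H + cost len H' := by
  classical
  simp only [cost_eq_sum_ite, ← Finset.sum_add_distrib]
  refine Finset.sum_le_sum fun e _ => ?_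
  have := hlen e
  simp only [SimpleGraph.edgeSet_sup, Set.mem_union]
  split_ifs <;> simp_all

theorem cost_sup_of_disjoint {H H' : SimpleGraph V} (h : Disjoint H H') :
    cost len (H ⊔ H') = cost len H + cost len H' := by
  classical
  simp only [cost_eq_sum_ite, ← Finset.sum_add_distrib]
  refine Finset.sum_congr rfl fun e _ => ?_
  have h' : e ∈ H.edgeSet → e ∉ H'.edgeSet := fun h1 h2 =>
    Set.disjoint_left.1 (SimpleGraph.disjoint_edgeSet.2 h) h1 h2
  simp only [SimpleGraph.edgeSet_sup, Set.mem_union]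
  split_ifs <;> simp_all

theorem cost_edge {u v : V} (h : u ≠ v) : cost len (SimpleGraph.edge u v) = len s(u, v) := by
  classical
  simp [cost_eq_sum_ite, SimpleGraph.edgeSet_edge_of_ne h]

theorem cost_edge_le (hlen : ∀ e, 0 ≤ len e) (u v : V) :
    cost len (SimpleGraph.edge u v) ≤ len s(u, v) := by
  by_cases h : u = v
  · subst h
    simpa [cost_bot] using hlen _
  · exact (cost_edge h).le

theorem cost_iSup_le {ι : Type*} [Fintype ι] (hlen : ∀ e, 0 ≤ len e) (H : ι → SimpleGraph V) :
    cost len (⨆ i, H i) ≤ ∑ i, cost len (H i) := by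
  classical
  rw [← Finset.sup_univ_eq_iSup]
  generalize (Finset.univ : Finset ι) = s
  induction s using Finset.induction_on with
  | empty => simp [cost_bot]
  | insert i s hi ih =>
    rw [Finset.sup_insert, Finset.sum_insert hi]
    exact (cost_sup_le hlen _ _).trans (by gcongr)

end cost

/-! ### Total width -/

variable [PseudoMetricSpace V]

/-- Passing from a feasible `H` to a coarser partition into components loses the widths of all but
one of the components that are merged: the width of a merged component is the largest width of its
parts, because no terminal pair of `H` is separated. -/
theorem totalWidth_le_of_reachable {P : Finset (V × V)} {H H' : SimpleGraph V}
    (hH : Feasible P H) (hle : ∀ a b, H.Reachable a b → H'.Reachable a b)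
    (S : Finset H.ConnectedComponent)
    (hS : ∀ a b, H.connectedComponentMk a ∈ S → H.connectedComponentMk b ∈ S → H'.Reachable a b)
    {W : ℝ} (hW0 : 0 ≤ W) (hW : ∀ C ∈ S, (width P C : ℝ) ≤ W) :
    totalWidth P H' ≤ totalWidth P H - ∑ C ∈ S, (width P C : ℝ) + W := by
  classical
  let q : H.ConnectedComponent → H'.ConnectedComponent :=
    SimpleGraph.ConnectedComponent.lift (fun v => H'.connectedComponentMk v)
      fun a b p _ => SimpleGraph.ConnectedComponent.sound (hle a b ⟨p⟩)
  -- every component of `H'` contains a component of `H` of at least the same width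
  have hg : ∀ C' : H'.ConnectedComponent, ∃ C : H.ConnectedComponent,
      q C = C' ∧ width P C' ≤ width P C := by
    intro C'
    set Q := P.filter fun p => p.1 ∈ C'.supp ∧ p.2 ∈ C'.supp with hQ
    rcases Q.eq_empty_or_nonempty with hemp | hne
    · induction C' using SimpleGraph.ConnectedComponent.ind with | _ v =>
      refine ⟨H.connectedComponentMk v, rfl, ?_⟩
      have : width P (H'.connectedComponentMk v) = 0 := by
        rw [width, ← hQ, hemp]
        rfl
      simp [this]
    · obtain ⟨p, hp, hmax⟩ := Q.exists_mem_eq_sup hne fun p => nndist p.1 p.2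
      have hp' := hp
      rw [hQ, Finset.mem_filter] at hp'
      obtain ⟨hpP, hp1, -⟩ := hp'
      refine ⟨H.connectedComponentMk p.1, hp1, ?_⟩
      calc width P C' = nndist p.1 p.2 := hmax
        _ ≤ width P (H.connectedComponentMk p.1) := by
          refine Finset.le_sup (f := fun p : V × V => nndist p.1 p.2) ?_
          simp only [Finset.mem_filter, SimpleGraph.ConnectedComponent.mem_supp_iff, true_and, hpP]
          exact SimpleGraph.ConnectedComponent.sound (hH p hpP).symm
  choose g hgq hgw using hg
  have hginj : Function.Injective g := fun a b h => by rw [← hgq a, ← hgq b, h]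
  let R := (Finset.univ : Finset H'.ConnectedComponent).image g
  have h1 : totalWidth P H' ≤ ∑ C ∈ R, (width P C : ℝ) := by
    rw [Finset.sum_image fun a _ b _ h => hginj h]
    exact Finset.sum_le_sum fun C' _ => by exact_mod_cast hgw C'
  have hsub : ∀ C ∈ S, ∀ D ∈ S, q C = q D := by
    intro C hC D hD
    induction C using SimpleGraph.ConnectedComponent.ind with | _ a =>
    induction D using SimpleGraph.ConnectedComponent.ind with | _ b =>
    exact SimpleGraph.ConnectedComponent.sound (hS a b hC hD)
  have h2 : ∑ C ∈ R ∩ S, (width P C : ℝ) ≤ W := by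
    rcases (R ∩ S).eq_empty_or_nonempty with hemp | ⟨C, hC⟩
    · simpa [hemp] using hW0
    · have : R ∩ S = {C} := by
        refine Finset.eq_singleton_iff_unique_mem.2 ⟨hC, fun D hD => ?_⟩
        rw [Finset.mem_inter] at hC hD
        obtain ⟨C', -, rfl⟩ := Finset.mem_image.1 hC.1
        obtain ⟨D', -, rfl⟩ := Finset.mem_image.1 hD.1
        rw [← hgq D', ← hgq C', hsub _ hD.2 _ hC.2]
      rw [this, Finset.sum_singleton]
      exact hW C (Finset.mem_inter.1 hC).2
  have h3 : ∑ C ∈ R \ S, (width P C : ℝ) ≤ ∑ C ∈ Finset.univ \ S, (width P C : ℝ) :=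
    Finset.sum_le_sum_of_subset_of_nonneg
      (Finset.sdiff_subset_sdiff (Finset.subset_univ _) le_rfl) fun _ _ _ => NNReal.coe_nonneg _
  have h4 : ∑ C ∈ Finset.univ \ S, (width P C : ℝ) + ∑ C ∈ S, (width P C : ℝ) = totalWidth P H :=
    Finset.sum_sdiff (Finset.subset_univ S)
  have h5 := Finset.sum_inter_add_sum_sdiff R S fun C => (width P C : ℝ)
  linarith

theorem totalWidth_anti {P : Finset (V × V)} {H H' : SimpleGraph V}
    (hH : Feasible P H) (hle : ∀ a b, H.Reachable a b → H'.Reachable a b) :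
    totalWidth P H' ≤ totalWidth P H := by
  simpa using totalWidth_le_of_reachable hH hle ∅ (by simp) le_rfl (by simp)

end

section

variable {V : Type*}

/-! ### Contracted paths -/

theorem Shrunk.refl (A : SimpleGraph V) (u x : V) : Shrunk A u x x := .inl rfl

theorem Shrunk.symm {A : SimpleGraph V} {u x y : V} (h : Shrunk A u x y) : Shrunk A u y x := by
  rcases h with rfl | ⟨h, h'⟩
  · exact .inl rfl
  · exact .inr ⟨h.symm, fun hu => h' (hu.trans h.symm)⟩

theorem Shrunk.trans {A : SimpleGraph V} {u x y z : V} (h : Shrunk A u x y)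
    (h' : Shrunk A u y z) : Shrunk A u x z := by
  rcases h with rfl | ⟨h, hu⟩
  · exact h'
  · rcases h' with rfl | ⟨h', -⟩
    · exact .inr ⟨h, hu⟩
    · exact .inr ⟨h.trans h', hu⟩

theorem Shrunk.eq_of_reachable {A : SimpleGraph V} {u x v : V} (h : Shrunk A u x v)
    (hv : A.Reachable u v) : x = v := by
  rcases h with rfl | ⟨h, hu⟩
  · rfl
  · exact absurd (hv.trans h.symm) hu

/-- Cutting out closed subwalks turns a walk in the contracted graph into a path. -/
theorem exists_sublist_simple (A : SimpleGraph V) (u : V) (l : List (V × V)) :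
    ∀ e₀ : V × V, List.IsChain (fun e e' : V × V => Shrunk A u e.2 e'.1) (e₀ :: l) →
      ∃ l' : List (V × V), l'.Sublist l ∧
        List.IsChain (fun e e' : V × V => Shrunk A u e.2 e'.1) (e₀ :: l') ∧
        ((e₀ :: l').map Prod.snd).Pairwise (fun x y => ¬ Shrunk A u x y) ∧
        Shrunk A u ((e₀ :: l').getLast (List.cons_ne_nil _ _)).2
          ((e₀ :: l).getLast (List.cons_ne_nil _ _)).2 := by
  induction l with
  | nil => exact fun e₀ _ => ⟨[], by simp [Shrunk.refl]⟩
  | cons f l ih =>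
    intro e₀ hch
    obtain ⟨hef, hfl⟩ := List.isChain_cons_cons.1 hch
    obtain ⟨l', hsub, hch', hpw, hlast⟩ := ih f hfl
    by_cases hg : ∃ g ∈ f :: l', Shrunk A u e₀.2 g.2
    · -- the walk comes back to its starting point with the edge `g`
      obtain ⟨g, hgm, hg⟩ := hg
      obtain ⟨a, b, hab⟩ := List.append_of_mem hgm
      have hbsub : b.Sublist (f :: l') := by
        rw [hab]
        exact (List.sublist_cons_self g b).trans (List.sublist_append_right a (g :: b))
      refine ⟨b, hbsub.trans (hsub.cons_cons f), ?_, ?_, ?_⟩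
      · have hgb : List.IsChain (fun e e' : V × V => Shrunk A u e.2 e'.1) (g :: b) := by
          rw [hab] at hch'
          exact hch'.right_of_append
        cases b with
        | nil => simp
        | cons h b =>
          rw [List.isChain_cons_cons] at hgb ⊢
          exact ⟨hg.trans hgb.1, hgb.2⟩
      · rw [hab, List.map_append, List.pairwise_append, List.map_cons, List.pairwise_cons] at hpw
        rw [List.map_cons, List.pairwise_cons]
        exact ⟨fun x hx hx' => hpw.2.1.1 x hx (hg.symm.trans hx'), hpw.2.1.2⟩
      · rw [List.getLast_cons_cons]
        refine Shrunk.trans ?_ hlast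
        have : (f :: l').getLast (List.cons_ne_nil _ _)
            = (g :: b).getLast (List.cons_ne_nil _ _) := by
          simp only [hab]
          exact List.getLast_append_of_ne_nil _ (by simp)
        rw [this]
        cases b with
        | nil => exact hg
        | cons h b => exact Shrunk.refl A u _
    · push Not at hg
      refine ⟨f :: l', hsub.cons_cons f, List.isChain_cons_cons.2 ⟨hef, hch'⟩, ?_,
        by simpa using hlast⟩
      rw [List.map_cons, List.pairwise_cons]
      refine ⟨fun x hx => ?_, hpw⟩
      obtain ⟨g, hgm, rfl⟩ := List.mem_map.1 hx
      exact hg g hgm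

theorem finite_isContractedPath [Finite V] (A : SimpleGraph V) (u v : V) :
    {l | IsContractedPath A u v l}.Finite := by
  have := Fintype.ofFinite V
  refine (List.finite_length_le (V × V) (Fintype.card V)).subset fun l hl => ?_
  have hnd : (((u, u) :: l).map Prod.snd).Nodup :=
    hl.simple.imp fun h => by
      rintro rfl
      exact h (Shrunk.refl A u _)
  have := hnd.length_le_card
  simp only [List.length_map, List.length_cons] at this
  exact (Nat.le_succ _).trans this

theorem isContractedPath_singleton {A : SimpleGraph V} {u v : V} (h : u ≠ v) :
    IsContractedPath A u v [(u, v)] where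
  chain := by simp [Shrunk.refl]
  last := rfl
  simple := by simp [Shrunk, h]
  avoid := by simp

section metric

variable [PseudoMetricSpace V]

theorem contractedLength_nonneg (l : List (V × V)) : 0 ≤ contractedLength l :=
  List.sum_nonneg fun x hx => by
    obtain ⟨e, -, rfl⟩ := List.mem_map.1 hx
    exact dist_nonneg

/-- The length of a shortest contracted path from `u` to `v`. -/
noncomputable def contractedDist (A : SimpleGraph V) (u v : V) : ℝ :=
  sInf (contractedLength '' {l | IsContractedPath A u v l})

theorem contractedDist_nonneg (A : SimpleGraph V) (u v : V) : 0 ≤ contractedDist A u v :=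
  Real.sInf_nonneg fun x hx => by
    obtain ⟨l, -, rfl⟩ := hx
    exact contractedLength_nonneg l

theorem contractedDist_le {A : SimpleGraph V} {u v : V} {l : List (V × V)}
    (hl : IsContractedPath A u v l) : contractedDist A u v ≤ contractedLength l :=
  csInf_le ⟨0, fun x hx => by
    obtain ⟨l, -, rfl⟩ := hx
    exact contractedLength_nonneg l⟩ ⟨l, hl, rfl⟩

theorem contractedDist_le_dist {A : SimpleGraph V} {u v : V} (h : u ≠ v) :
    contractedDist A u v ≤ dist u v := by
  simpa [contractedLength] using contractedDist_le (isContractedPath_singleton (A := A) h)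

theorem exists_isShortestContractedPath [Finite V] (A : SimpleGraph V) {u v : V} (h : u ≠ v) :
    ∃ l, IsShortestContractedPath A u v l ∧ contractedLength l = contractedDist A u v := by
  obtain ⟨l, hl, hmin⟩ := Set.exists_min_image _ contractedLength (finite_isContractedPath A u v)
    ⟨_, isContractedPath_singleton h⟩
  refine ⟨l, ⟨hl, hmin⟩, le_antisymm (le_csInf ⟨_, l, hl, rfl⟩ ?_) (contractedDist_le hl)⟩
  rintro _ ⟨l', hl', rfl⟩
  exact hmin l' hl'

/-- The length of a shortest contracted path is at most the length of any contracted walk. -/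
theorem contractedDist_le_of_walk {A : SimpleGraph V} {u v : V} (huv : A.Reachable u v)
    {l : List (V × V)}
    (chain : List.IsChain (fun e e' : V × V => Shrunk A u e.2 e'.1) ((u, u) :: l))
    (last : (((u, u) :: l).getLast (List.cons_ne_nil _ _)).2 = v)
    (avoid : ∀ e ∈ l, (A.Reachable u e.1 → e.1 = u) ∧ (A.Reachable u e.2 → e.2 = v)) :
    contractedDist A u v ≤ contractedLength l := by
  obtain ⟨l', hsub, hch, hpw, hl⟩ := exists_sublist_simple A u l (u, u) chain
  have hpath : IsContractedPath A u v l' :=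
    ⟨hch, Shrunk.eq_of_reachable (last ▸ hl) huv, hpw, fun e he => avoid e (hsub.subset he)⟩
  refine (contractedDist_le hpath).trans (List.Sublist.sum_le_sum (hsub.map _) fun x hx => ?_)
  obtain ⟨e, -, rfl⟩ := List.mem_map.1 hx
  exact dist_nonneg

/-- The edge lengths that witness the theorem: an edge inside a component of `A` is as long as a
shortest contracted path between its ends. The maximum over the two orientations (which have the
same value) makes the definition symmetric. -/
noncomputable def contractedEdgeLength (A : SimpleGraph V) : Sym2 V → ℝ := by
  classical
  exact Sym2.lift ⟨fun u v => if A.Reachable u v ∧ u ≠ v then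
    max (contractedDist A u v) (contractedDist A v u) else 0, fun u v => by
      simp only [SimpleGraph.reachable_comm (u := u), max_comm (contractedDist A u v), ne_comm]⟩

open scoped Classical in
theorem contractedEdgeLength_mk (A : SimpleGraph V) (u v : V) :
    contractedEdgeLength A s(u, v) = if A.Reachable u v ∧ u ≠ v then
      max (contractedDist A u v) (contractedDist A v u) else 0 := rfl

theorem contractedEdgeLength_nonneg (A : SimpleGraph V) (e : Sym2 V) :
    0 ≤ contractedEdgeLength A e := by
  induction e with | _ u v =>
  rw [contractedEdgeLength_mk]
  split_ifs
  · exact le_max_of_le_left (contractedDist_nonneg A u v)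
  · exact le_rfl

theorem contractedEdgeLength_le (A : SimpleGraph V) (e : Sym2 V) :
    contractedEdgeLength A e ≤ edgeLength e := by
  induction e with | _ u v =>
  rw [contractedEdgeLength_mk, edgeLength_mk]
  split_ifs with h
  · exact max_le (contractedDist_le_dist h.2) (dist_comm u v ▸ contractedDist_le_dist h.2.symm)
  · exact dist_nonneg

end metric

/-! ### Swap-optimality for the contracted edge lengths -/

/-- If the edges `S` lie in the component of `u`, then a contracted path from `u` to `v` also
connects `u` to `v` once `S` has been removed from `A`, because the other components are intact. -/
theorem reachable_of_isContractedPath {A : SimpleGraph V} {u v : V} {S : Set (Sym2 V)}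
    (hS : ∀ x y, s(x, y) ∈ S → A.Reachable u x) {l : List (V × V)}
    (hl : IsContractedPath A u v l) : (A.deleteEdges S ⊔ pathEdges l).Reachable u v := by
  -- shrunk points are connected without `S`
  have hshr : ∀ x y, Shrunk A u x y → (A.deleteEdges S).Reachable x y := by
    rintro x y (rfl | ⟨hxy, hu⟩)
    · exact .rfl
    · obtain ⟨p⟩ := hxy
      induction p with
      | nil => exact .rfl
      | @cons a b c hab _ ih =>
        refine (SimpleGraph.Adj.reachable ?_).trans (ih fun h => hu (h.trans hab.symm.reachable))
        exact SimpleGraph.deleteEdges_adj.2 ⟨hab, fun h => hu (hS _ _ h)⟩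
  have key : ∀ (m : List (V × V)) (e₀ : V × V) (G : SimpleGraph V),
      (∀ e ∈ m, G.Reachable e.1 e.2) → (∀ x y, Shrunk A u x y → G.Reachable x y) →
      List.IsChain (fun e e' : V × V => Shrunk A u e.2 e'.1) (e₀ :: m) →
      G.Reachable e₀.2 ((e₀ :: m).getLast (List.cons_ne_nil _ _)).2 := by
    intro m
    induction m with
    | nil => exact fun _ _ _ _ _ => .rfl
    | cons f m ih =>
      intro e₀ G hG hG' hch
      rw [List.isChain_cons_cons] at hch
      rw [List.getLast_cons_cons]
      exact ((hG' _ _ hch.1).trans (hG f (by simp))).trans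
        (ih f G (fun e he => hG e (by simp [he])) hG' hch.2)
  have := key l (u, u) (A.deleteEdges S ⊔ pathEdges l) (fun e he => ?_)
    (fun x y h => (hshr x y h).mono le_sup_left) hl.chain
  · rwa [hl.last] at this
  · by_cases h : e.1 = e.2
    · exact h ▸ .rfl
    · refine SimpleGraph.Adj.reachable (Or.inr ?_)
      exact (SimpleGraph.fromEdgeSet_adj _).2 ⟨⟨e, he, rfl⟩, h⟩

theorem cost_pathEdges_le [Fintype V] [PseudoMetricSpace V] (l : List (V × V)) :
    cost edgeLength (pathEdges l) ≤ contractedLength l := by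
  induction l with
  | nil => simp [pathEdges, contractedLength, cost_bot]
  | cons e l ih =>
    have : pathEdges (e :: l) ≤ SimpleGraph.edge e.1 e.2 ⊔ pathEdges l := by
      intro a b hab
      rw [pathEdges, SimpleGraph.fromEdgeSet_adj] at hab
      obtain ⟨⟨f, hf, hf'⟩, hne⟩ := hab
      rcases List.mem_cons.1 hf with rfl | hf
      · exact .inl (by rw [SimpleGraph.edge, SimpleGraph.fromEdgeSet_adj]; exact ⟨hf', hne⟩)
      · exact .inr ((SimpleGraph.fromEdgeSet_adj _).2 ⟨⟨f, hf, hf'⟩, hne⟩)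
    calc cost edgeLength (pathEdges (e :: l))
        ≤ cost edgeLength (SimpleGraph.edge e.1 e.2 ⊔ pathEdges l) :=
          cost_mono edgeLength_nonneg this
      _ ≤ cost edgeLength (SimpleGraph.edge e.1 e.2) + cost edgeLength (pathEdges l) :=
          cost_sup_le edgeLength_nonneg _ _
      _ ≤ dist e.1 e.2 + contractedLength l :=
          add_le_add (cost_edge_le edgeLength_nonneg e.1 e.2) ih
      _ = contractedLength (e :: l) := by simp [contractedLength]

theorem edgeSetSwapOptimal_contractedEdgeLength [Fintype V] [PseudoMetricSpace V]
    {P : Finset (V × V)} {A B : SimpleGraph V} (hA : PathSetSwapOptimal P A)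
    (hB : ∀ u v, B.Adj u v → A.Reachable u v) :
    EdgeSetSwapOptimal P A B (contractedEdgeLength A) := by
  classical
  intro u v huv S hS
  obtain ⟨l, hl, hlen⟩ := exists_isShortestContractedPath A huv.ne
  refine (hA u v huv.ne S hS l hl).trans ?_
  obtain ⟨p, -, f, -, piece, -, rfl, -, hfeas⟩ := hS
  set S := {g | g ∈ removable P A p f ∧ g ∈ piece} with hS
  have hSu : ∀ x y, s(x, y) ∈ S → A.Reachable u x := fun x y h =>
    ⟨p.takeUntil x (p.fst_mem_support_of_mem_edges h.1.1)⟩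
  have hw : totalWidth P (A.deleteEdges S ⊔ pathEdges l)
      ≤ totalWidth P (A.deleteEdges S ⊔ SimpleGraph.edge u v) := by
    refine totalWidth_anti hfeas fun a b hab => reachable_of_forall_adj (fun x y hxy => ?_) hab
    have huv := reachable_of_isContractedPath hSu hl.1
    rw [SimpleGraph.sup_adj, SimpleGraph.edge_adj] at hxy
    rcases hxy with hxy | ⟨⟨rfl, rfl⟩ | ⟨rfl, rfl⟩, -⟩
    · exact hxy.reachable.mono le_sup_left
    · exact huv
    · exact huv.symm
  have hc := cost_sup_le edgeLength_nonneg (A.deleteEdges S) (pathEdges l)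
  have hc' := cost_pathEdges_le l
  have hlen' : contractedDist A u v ≤ contractedEdgeLength A s(u, v) := by
    rw [contractedEdgeLength_mk, if_pos ⟨hB u v huv, huv.ne⟩]
    exact le_max_left _ _
  rw [potential, swapPotential]
  linarith

/-- Removing an edge of the cycle closed by `uv` does not disconnect anything. -/
theorem Feasible.edgeEdgeSwap {P : Finset (V × V)} {A : SimpleGraph V} (hA : Feasible P A)
    {u v : V} {p : A.Walk u v} (hp : p.IsPath) {f : Sym2 V} (hf : f ∈ p.edges) :
    Feasible P (A.deleteEdges {f} ⊔ SimpleGraph.edge u v) := by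
  classical
  induction f with | _ x y =>
  set G := A.deleteEdges {s(x, y)} ⊔ SimpleGraph.edge u v
  -- a walk splits at its unique traversal of the edge `xy`
  have key : ∀ {a b : V} (q : A.Walk a b), q.edges.Nodup → s(x, y) ∈ q.edges →
      (A.deleteEdges {s(x, y)}).Reachable a x ∧ (A.deleteEdges {s(x, y)}).Reachable y b ∨
      (A.deleteEdges {s(x, y)}).Reachable a y ∧ (A.deleteEdges {s(x, y)}).Reachable x b := by
    intro a b q
    induction q with
    | nil => simp
    | @cons a c b hac q ih =>
      intro hnd hmem
      rw [SimpleGraph.Walk.edges_cons, List.nodup_cons] at hnd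
      by_cases heq : s(x, y) = s(a, c)
      · have hq : (A.deleteEdges {s(x, y)}).Reachable c b :=
          ⟨q.toDeleteEdge s(x, y) (heq ▸ hnd.1)⟩
        rcases Sym2.eq_iff.1 heq with ⟨rfl, rfl⟩ | ⟨rfl, rfl⟩
        · exact .inl ⟨.rfl, hq⟩
        · exact .inr ⟨.rfl, hq⟩
      · have hac' : (A.deleteEdges {s(x, y)}).Reachable a c :=
          SimpleGraph.Adj.reachable (SimpleGraph.deleteEdges_adj.2 ⟨hac, fun h => heq h.symm⟩)
        rw [SimpleGraph.Walk.edges_cons, List.mem_cons] at hmem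
        exact (ih hnd.2 (hmem.resolve_left heq)).imp (And.imp_left hac'.trans)
          (And.imp_left hac'.trans)
  have hvu : G.Reachable u v := (edge_reachable u v).mono le_sup_right
  have hle : A.deleteEdges {s(x, y)} ≤ G := le_sup_left
  have hxy : G.Reachable x y := by
    rcases key p hp.isTrail.edges_nodup hf with ⟨h1, h2⟩ | ⟨h1, h2⟩
    · exact ((h1.mono hle).symm.trans hvu).trans (h2.mono hle).symm
    · exact ((h2.mono hle).trans hvu.symm).trans (h1.mono hle)
  refine fun q hq => reachable_of_forall_adj (fun a b hab => ?_) (hA q hq)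
  by_cases heq : s(a, b) = s(x, y)
  · rcases Sym2.eq_iff.1 heq with ⟨rfl, rfl⟩ | ⟨rfl, rfl⟩
    · exact hxy
    · exact hxy.symm
  · exact (SimpleGraph.Adj.reachable (SimpleGraph.deleteEdges_adj.2 ⟨hab, heq⟩)).mono hle

/-- An edge/edge swap is an edge/set swap whose piece is a single edge. -/
theorem IsEdgeEdgeSwap.isEdgeSetSwap {P : Finset (V × V)} {A : SimpleGraph V} (hA : Feasible P A)
    {u v : V} {f : Sym2 V} (h : IsEdgeEdgeSwap A u v f) : IsEdgeSetSwap P A u v {f} := by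
  obtain ⟨p, hp, hf⟩ := h
  refine ⟨p, hp, f, hf, [f], ?_, ?_, Set.singleton_nonempty f, hA.edgeEdgeSwap hp hf⟩
  · obtain ⟨a, b, hab⟩ := List.append_of_mem hf
    exact ⟨a, b, by simp [hab]⟩
  · ext g
    simp only [Set.mem_singleton_iff, List.mem_singleton, Set.mem_ofPred_eq, removable]
    exact ⟨fun h => ⟨⟨h ▸ hf, .inl h⟩, h⟩, And.right⟩

theorem EdgeSetSwapOptimal.edgeEdgeSwapOptimal [Fintype V] [PseudoMetricSpace V]
    {P : Finset (V × V)} {A B : SimpleGraph V} {len : Sym2 V → ℝ} (hA : Feasible P A)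
    (h : EdgeSetSwapOptimal P A B len) : EdgeEdgeSwapOptimal P A B len :=
  fun u v huv _ hf => h u v huv _ (hf.isEdgeSetSwap hA)

end

section

variable {V : Type*}

/-! ### Charging widths to connecting moves -/

/-- The graph formed by a multiset of edges, given as ordered pairs; loops are dropped. -/
def edgesGraph (E : Multiset (V × V)) : SimpleGraph V :=
  SimpleGraph.fromEdgeSet {e | ∃ x ∈ E, e = s(x.1, x.2)}

theorem edgesGraph_reachable {E : Multiset (V × V)} {e : V × V} (he : e ∈ E) :
    (edgesGraph E).Reachable e.1 e.2 := by
  by_cases h : e.1 = e.2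
  · exact h ▸ .rfl
  · exact SimpleGraph.Adj.reachable ((SimpleGraph.fromEdgeSet_adj _).2 ⟨⟨e, he, rfl⟩, h⟩)

theorem edgesGraph_mono {E E' : Multiset (V × V)} (h : E ⊆ E') : edgesGraph E ≤ edgesGraph E' :=
  SimpleGraph.fromEdgeSet_mono fun _ ⟨x, hx, he⟩ => ⟨x, h hx, he⟩

theorem edgesGraph_cons (e : V × V) (E : Multiset (V × V)) :
    edgesGraph (e ::ₘ E) = edgesGraph E ⊔ SimpleGraph.edge e.1 e.2 := by
  rw [edgesGraph, edgesGraph, SimpleGraph.edge, ← SimpleGraph.fromEdgeSet_union]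
  congr 1
  ext f
  simp

/-- Total length of a multiset of edges. -/
noncomputable def edgesLength [PseudoMetricSpace V] (E : Multiset (V × V)) : ℝ :=
  (E.map fun e => dist e.1 e.2).sum

theorem edgesLength_add [PseudoMetricSpace V] (E E' : Multiset (V × V)) :
    edgesLength (E + E') = edgesLength E + edgesLength E' := by
  simp [edgesLength]

theorem cost_edgesGraph_le [Fintype V] [PseudoMetricSpace V] (E : Multiset (V × V)) :
    cost edgeLength (edgesGraph E) ≤ edgesLength E := by
  induction E using Quotient.inductionOn with | _ l =>
  simpa [edgesLength, contractedLength, edgesGraph, pathEdges] using cost_pathEdges_le l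

/-- `Chargeable A w t E x`: the edges `E` can be partitioned into connected pieces of the contracted
multigraph `G / A` whose gains add up to at least `x`. A piece that connects the components in `S`
has gain `∑ C ∈ S, w C - W`, where `W` bounds the weights in `S`; only components of weight at least
`t` may be used. -/
inductive Chargeable (A : SimpleGraph V) (w : A.ConnectedComponent → ℝ) (t : ℝ) :
    Multiset (V × V) → ℝ → Prop
  | piece (E : Multiset (V × V)) (S : Finset A.ConnectedComponent) (W x : ℝ)
      (hconn : ∀ a b, A.connectedComponentMk a ∈ S → A.connectedComponentMk b ∈ S →
        (A ⊔ edgesGraph E).Reachable a b)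
      (hW0 : 0 ≤ W) (hW : ∀ C ∈ S, w C ≤ W) (ht : ∀ C ∈ S, t ≤ w C)
      (hx : x ≤ ∑ C ∈ S, w C - W) : Chargeable A w t E x
  | add (E E' : Multiset (V × V)) (x x' : ℝ) (h : Chargeable A w t E x)
      (h' : Chargeable A w t E' x') : Chargeable A w t (E + E') (x + x')

section

variable {A : SimpleGraph V} {w : A.ConnectedComponent → ℝ}

theorem Chargeable.mono {t t' : ℝ} (ht : t' ≤ t) {E : Multiset (V × V)} {x : ℝ}
    (h : Chargeable A w t E x) : Chargeable A w t' E x := by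
  induction h with
  | piece E S W x hconn hW0 hW ht' hx =>
    exact .piece E S W x hconn hW0 hW (fun C hC => ht.trans (ht' C hC)) hx
  | add E E' x x' _ _ ih ih' => exact .add E E' x x' ih ih'

/-- A single edge between two distinct components gains the smaller of their weights. -/
theorem Chargeable.single (hw : ∀ C, 0 ≤ w C) {x y : V} {C D : A.ConnectedComponent}
    (hC : A.connectedComponentMk x = C) (hD : A.connectedComponentMk y = D) (hne : C ≠ D) :
    Chargeable A w (min (w C) (w D)) {(x, y)} (min (w C) (w D)) := by
  classical
  subst hC hD
  have hxy : (A ⊔ edgesGraph {(x, y)}).Reachable x y :=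
    (edgesGraph_reachable (e := (x, y)) (by simp)).mono le_sup_right
  have hcl : ∀ a, A.connectedComponentMk a ∈
      ({A.connectedComponentMk x, A.connectedComponentMk y} : Finset A.ConnectedComponent) →
      (A ⊔ edgesGraph {(x, y)}).Reachable a x := by
    intro a ha
    rw [Finset.mem_insert, Finset.mem_singleton, SimpleGraph.ConnectedComponent.eq,
      SimpleGraph.ConnectedComponent.eq] at ha
    rcases ha with ha | ha
    · exact ha.mono le_sup_left
    · exact (ha.mono le_sup_left).trans hxy.symm
  refine .piece _ {A.connectedComponentMk x, A.connectedComponentMk y}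
    (max (w (A.connectedComponentMk x)) (w (A.connectedComponentMk y))) _
    (fun a b ha hb => (hcl a ha).trans (hcl b hb).symm) (le_max_of_le_left (hw _)) ?_ ?_ ?_
  · simp
  · simp
  · rw [Finset.sum_pair hne, ← min_add_max, add_sub_cancel_right]

/-- Subdividing an edge by a visit of a component `C` of smallest weight increases the gain by
`w C`. If the piece of the subdivided edge did not use `C` yet, it now connects `C` as well.
Otherwise the two halves of the edge close a cycle in the piece, and one of them can be split off as
a piece of its own. -/
theorem Chargeable.subdivide (hw : ∀ C, 0 ≤ w C) {b a₁ a₂ c : V} {C : A.ConnectedComponent}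
    (ha₁ : A.connectedComponentMk a₁ = C) (ha₂ : A.connectedComponentMk a₂ = C)
    (hb : A.connectedComponentMk b ≠ C) (hbw : w C ≤ w (A.connectedComponentMk b))
    (hc : A.connectedComponentMk c ≠ C) (hcw : w C ≤ w (A.connectedComponentMk c))
    {E₀ : Multiset (V × V)} {x : ℝ} (h : Chargeable A w (w C) E₀ x) :
    ∀ E, E₀ = (b, c) ::ₘ E → Chargeable A w (w C) ((b, a₁) ::ₘ (a₂, c) ::ₘ E) (x + w C) := by
  classical
  have hba : Chargeable A w (w C) {(b, a₁)} (w C) := by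
    simpa [min_eq_right hbw] using Chargeable.single hw rfl ha₁ hb
  have hac : Chargeable A w (w C) {(a₂, c)} (w C) := by
    simpa [min_eq_left hcw] using Chargeable.single hw ha₂ rfl hc.symm
  induction h with
  | piece E₀ S W x hconn hW0 hW ht hx =>
    rintro E rfl
    by_cases h2 : ∀ p q, A.connectedComponentMk p ∈ S → A.connectedComponentMk q ∈ S →
        (A ⊔ edgesGraph ((a₂, c) ::ₘ E)).Reachable p q
    · have := (Chargeable.piece _ S W x h2 hW0 hW ht hx).add _ _ _ _ hba
      rwa [add_comm, Multiset.singleton_add] at this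
    by_cases h3 : ∀ p q, A.connectedComponentMk p ∈ S → A.connectedComponentMk q ∈ S →
        (A ⊔ edgesGraph ((b, a₁) ::ₘ E)).Reachable p q
    · have := (Chargeable.piece _ S W x h3 hW0 hW ht hx).add _ _ _ _ hac
      rwa [add_comm, Multiset.singleton_add, Multiset.cons_swap] at this
    have haa : A.Reachable a₁ a₂ := SimpleGraph.ConnectedComponent.exact (ha₁.trans ha₂.symm)
    have hsplit : A ⊔ edgesGraph ((b, c) ::ₘ E) = (A ⊔ edgesGraph E) ⊔ SimpleGraph.edge b c := by
      rw [edgesGraph_cons, sup_assoc]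
    have hle2 : A ⊔ edgesGraph E ≤ A ⊔ edgesGraph ((a₂, c) ::ₘ E) :=
      sup_le_sup_left (edgesGraph_mono (Multiset.subset_cons _ _)) _
    have hle3 : A ⊔ edgesGraph E ≤ A ⊔ edgesGraph ((b, a₁) ::ₘ E) :=
      sup_le_sup_left (edgesGraph_mono (Multiset.subset_cons _ _)) _
    have hE2 : (A ⊔ edgesGraph ((a₂, c) ::ₘ E)).Reachable a₂ c :=
      (edgesGraph_reachable (e := (a₂, c)) (by simp)).mono le_sup_right
    have hE3 : (A ⊔ edgesGraph ((b, a₁) ::ₘ E)).Reachable b a₁ :=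
      (edgesGraph_reachable (e := (b, a₁)) (by simp)).mono le_sup_right
    -- a graph that contains `A ∪ E` and connects `b` to `c` connects whatever `A ∪ E + bc` connects
    have hup : ∀ G : SimpleGraph V, A ⊔ edgesGraph E ≤ G → G.Reachable b c →
        ∀ p q, (A ⊔ edgesGraph ((b, c) ::ₘ E)).Reachable p q → G.Reachable p q := by
      intro G hG hbc p q hpq
      refine reachable_of_forall_adj (fun y z hyz => ?_) hpq
      rw [hsplit, SimpleGraph.sup_adj, SimpleGraph.edge_adj] at hyz
      rcases hyz with hyz | ⟨⟨rfl, rfl⟩ | ⟨rfl, rfl⟩, -⟩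
      · exact (hG hyz).reachable
      · exact hbc
      · exact hbc.symm
    -- as `h2` fails, `A ∪ E` does not connect `S`, so `S` is connected through the edge `bc`
    have hSb : ∃ p, A.connectedComponentMk p ∈ S ∧
        (A ⊔ edgesGraph ((b, c) ::ₘ E)).Reachable p b := by
      by_contra! hno
      refine h2 fun p q hp hq => ?_
      have hpq := hconn p q hp hq
      rw [hsplit] at hpq
      rcases reachable_or_of_reachable_sup_edge hpq with h | h | h
      · exact h.mono hle2
      · exact absurd (h.mono (hsplit ▸ le_sup_left)) (hno p hp)
      · refine absurd ((h.mono (hsplit ▸ le_sup_left)).trans ?_) (hno p hp)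
        exact (edgesGraph_reachable (e := (b, c)) (by simp)).symm.mono le_sup_right
    obtain ⟨p, hpS, hpb⟩ := hSb
    have hCS : C ∉ S := by
      intro hCS
      have hab : (A ⊔ edgesGraph ((b, c) ::ₘ E)).Reachable a₁ b :=
        (hconn a₁ p (ha₁ ▸ hCS) hpS).trans hpb
      rw [hsplit] at hab
      have : (A ⊔ edgesGraph E).Reachable a₁ b ∨ (A ⊔ edgesGraph E).Reachable a₁ c := by
        rcases reachable_or_of_reachable_sup_edge hab with h | h
        · exact .inl h
        · exact h
      rcases this with h | h
      · refine h2 fun p q hp hq => hup _ hle2 ?_ p q (hconn p q hp hq)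
        exact (h.mono hle2).symm.trans ((haa.mono le_sup_left).trans hE2)
      · exact h3 fun p q hp hq => hup _ hle3 (hE3.trans (h.mono hle3)) p q (hconn p q hp hq)
    set G := A ⊔ edgesGraph ((b, a₁) ::ₘ (a₂, c) ::ₘ E)
    have hG2 : A ⊔ edgesGraph ((a₂, c) ::ₘ E) ≤ G :=
      sup_le_sup_left (edgesGraph_mono (Multiset.subset_cons _ _)) _
    have hG3 : A ⊔ edgesGraph ((b, a₁) ::ₘ E) ≤ G := by
      refine sup_le_sup_left (edgesGraph_mono ?_) _
      rw [Multiset.cons_swap]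
      exact Multiset.subset_cons _ _
    have hba' : G.Reachable b a₁ := hE3.mono hG3
    have hbc : G.Reachable b c := (hba'.trans (haa.mono le_sup_left)).trans (hE2.mono hG2)
    have hall : ∀ q, A.connectedComponentMk q ∈ insert C S → G.Reachable q b := by
      intro q hq
      rcases Finset.mem_insert.1 hq with hq | hq
      · exact ((SimpleGraph.ConnectedComponent.exact (hq.trans ha₁.symm)).mono le_sup_left).trans
          hba'.symm
      · exact hup G (hle2.trans hG2) hbc q b ((hconn q p hq hpS).trans hpb)
    refine .piece _ (insert C S) W _ (fun q r hq hr => (hall q hq).trans (hall r hr).symm) hW0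
      ?_ ?_ ?_
    · exact Finset.forall_mem_insert _ _ _ |>.2 ⟨(ht _ hpS).trans (hW _ hpS), hW⟩
    · exact Finset.forall_mem_insert _ _ _ |>.2 ⟨le_rfl, ht⟩
    · rw [Finset.sum_insert hCS]
      linarith
  | add E₁ E₂ x₁ x₂ h₁ h₂ ih₁ ih₂ =>
    intro E hE
    have hmem : (b, c) ∈ E₁ + E₂ := hE ▸ Multiset.mem_cons_self _ _
    rcases Multiset.mem_add.1 hmem with hm | hm
    · obtain ⟨E', rfl⟩ := Multiset.exists_cons_of_mem hm
      rw [Multiset.cons_add, Multiset.cons_inj_right] at hE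
      subst hE
      have := (ih₁ E' rfl).add _ _ _ _ h₂
      rwa [Multiset.cons_add, Multiset.cons_add, add_right_comm] at this
    · obtain ⟨E', rfl⟩ := Multiset.exists_cons_of_mem hm
      rw [Multiset.add_cons, Multiset.cons_inj_right] at hE
      subst hE
      have := Chargeable.add _ _ _ _ h₁ (ih₂ E' rfl)
      rwa [Multiset.add_cons, Multiset.add_cons, ← add_assoc] at this

end

/-- If there is no approximate connecting move, the gain of an edge set is at most `c` times its
length: a spanning forest of `A ∪ E` yields a connecting move for each piece. -/
theorem Chargeable.le_edgesLength [Fintype V] [PseudoMetricSpace V] {P : Finset (V × V)}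
    {A : SimpleGraph V} {c : ℝ} (hc : 0 ≤ c) (hAforest : A.IsAcyclic) (hA : Feasible P A)
    (hconnect : ApproxConnectingMoveOptimal P c A) {t : ℝ} {E : Multiset (V × V)} {x : ℝ}
    (h : Chargeable A (fun C => (width P C : ℝ)) t E x) : x ≤ c * edgesLength E := by
  induction h with
  | add E E' x x' _ _ ih ih' =>
    rw [edgesLength_add, mul_add]
    exact add_le_add ih ih'
  | piece E S W x hconn hW0 hW _ hx =>
    have hE0 : 0 ≤ edgesLength E := Multiset.sum_nonneg fun y hy => by
      obtain ⟨e, -, rfl⟩ := Multiset.mem_map.1 hy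
      exact dist_nonneg
    rcases S.eq_empty_or_nonempty with rfl | ⟨C, hC⟩
    · rw [Finset.sum_empty] at hx
      have := mul_nonneg hc hE0
      linarith
    induction C using SimpleGraph.ConnectedComponent.ind with | _ r =>
    obtain ⟨B, hAB, hB, hBacyc, hBreach⟩ :=
      SimpleGraph.exists_isAcyclic_reachable_eq_le_of_le_of_isAcyclic
        (le_sup_left : A ≤ A ⊔ edgesGraph E) hAforest
    let K : SimpleGraph V :=
      { Adj := fun a b => B.Adj a b ∧ ¬ A.Adj a b ∧ B.Reachable r a
        symm := ⟨fun a b h => ⟨h.1.symm, fun h' => h.2.1 h'.symm, h.2.2.trans h.1.reachable⟩⟩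
        loopless := ⟨fun a h => h.1.ne rfl⟩ }
    have hKB : A ⊔ K ≤ B := sup_le hAB fun a b h => h.1
    have hKE : K ≤ edgesGraph E := fun a b h => (hB h.1).resolve_left h.2.1
    have hreach : ∀ a, B.Reachable r a → (A ⊔ K).Reachable r a := by
      rintro a ⟨p⟩
      have key : ∀ {b a : V} (p : B.Walk b a), B.Reachable r b → (A ⊔ K).Reachable b a := by
        intro b a p
        induction p with
        | nil => exact fun _ => .rfl
        | @cons b d a hbd _ ih =>
          intro hb
          refine (SimpleGraph.Adj.reachable ?_).trans (ih (hb.trans hbd.reachable))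
          by_cases hbd' : A.Adj b d
          · exact .inl hbd'
          · exact .inr ⟨hbd, hbd', hb⟩
      exact key p .rfl
    have hSr : ∀ a, A.connectedComponentMk a ∈ S → (A ⊔ K).Reachable r a := fun a ha =>
      hreach a (by rw [hBreach]; exact hconn r a hC ha)
    have hwidth := totalWidth_le_of_reachable hA (H' := A ⊔ K)
      (fun a b hab => hab.mono le_sup_left) S (fun a b ha hb => (hSr a ha).symm.trans (hSr b hb))
      hW0 hW
    have hcost : cost edgeLength K ≤ edgesLength E :=
      (cost_mono edgeLength_nonneg hKE).trans (cost_edgesGraph_le E)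
    by_cases hK : K = ⊥
    · rw [hK, sup_bot_eq] at hwidth
      have := mul_nonneg hc hE0
      linarith
    · have hsupp : ∀ a ∈ K.support, (A ⊔ K).Reachable r a := by
        rintro a ⟨b, hab⟩
        exact hreach a hab.2.2
      have hmove := hconnect K ⟨hK, ?_, hBacyc.anti hKB, fun a ha b hb =>
        (hsupp a ha).symm.trans (hsupp b hb)⟩
      · have := mul_le_mul_of_nonneg_left hcost hc
        linarith
      · rw [disjoint_iff_inf_le]
        exact fun a b h => h.2.2.1 h.1

end

section

variable {V : Type*}

/-! ### Sequences of stops without guarded segments -/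

/-- The edges traversed by a sequence of stops. A stop is a pair of an entry and an exit vertex; the
edges lead from the exit of each stop to the entry of the next one. -/
def stopEdges : List (V × V) → List (V × V)
  | [] => []
  | [_] => []
  | s :: t :: l => (s.2, t.1) :: stopEdges (t :: l)

@[simp]
theorem stopEdges_nil : stopEdges ([] : List (V × V)) = [] := rfl

@[simp]
theorem stopEdges_singleton (s : V × V) : stopEdges [s] = [] := rfl

@[simp]
theorem stopEdges_cons_cons (s t : V × V) (l : List (V × V)) :
    stopEdges (s :: t :: l) = (s.2, t.1) :: stopEdges (t :: l) := rfl

theorem stopEdges_append_cons (l₁ : List (V × V)) (s : V × V) (l₂ : List (V × V)) :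
    stopEdges (l₁ ++ s :: l₂) = stopEdges (l₁ ++ [s]) ++ stopEdges (s :: l₂) := by
  induction l₁ with
  | nil => simp
  | cons a l₁ ih =>
    cases l₁ with
    | nil => simp
    | cons b l₁ => simpa using ih

/-- The component of `A` visited by a stop. -/
def stopComp (A : SimpleGraph V) (s : V × V) : A.ConnectedComponent :=
  A.connectedComponentMk s.1

/-- A sequence of stops is unguarded if between any two visits of the same component there is a
visit of a component of at least the same rank; that is, no segment between two visits of a
component passes through components of smaller rank only. -/
def Unguarded {R : Type*} [LE R] (A : SimpleGraph V) (rank : A.ConnectedComponent → R)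
    (l : List (V × V)) : Prop :=
  ∀ l₁ s m t l₂, l = l₁ ++ s :: m ++ t :: l₂ → stopComp A s = stopComp A t →
    ∃ r ∈ m, rank (stopComp A s) ≤ rank (stopComp A r)

/-- The position of a segment `s, m, t` of `l₁ ++ l₂` relative to an element inserted in between
`l₁` and `l₂`. -/
theorem exists_append_of_append_eq {α : Type*} {l₁ l₂ k₁ m k₂ : List α} {s t : α} (a : α)
    (h : l₁ ++ l₂ = k₁ ++ s :: m ++ t :: k₂) :
    ∃ k₁' k₂', l₁ ++ a :: l₂ = k₁' ++ s :: m ++ t :: k₂' ∨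
      ∃ m₁ m₂, m = m₁ ++ m₂ ∧ l₁ ++ a :: l₂ = k₁' ++ s :: (m₁ ++ a :: m₂) ++ t :: k₂' := by
  rw [List.append_assoc, List.append_eq_append_iff] at h
  rcases h with ⟨c, rfl, rfl⟩ | ⟨c, rfl, h⟩
  · exact ⟨l₁ ++ a :: c, k₂, .inl (by simp)⟩
  · rcases c with - | ⟨s', c⟩
    · refine ⟨k₁ ++ [a], k₂, .inl ?_⟩
      simp only [List.nil_append] at h
      simp [← h]
    · rw [List.cons_append, List.cons_append, List.cons.injEq] at h
      obtain ⟨rfl, h⟩ := h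
      rw [eq_comm, List.append_eq_append_iff] at h
      rcases h with ⟨d, rfl, rfl⟩ | ⟨d, rfl, h⟩
      · exact ⟨k₁, k₂, .inr ⟨c, d, rfl, by simp⟩⟩
      · rcases d with - | ⟨t', d⟩
        · simp only [List.nil_append] at h
          exact ⟨k₁, k₂, .inr ⟨m, [], by simp, by simp [← h]⟩⟩
        · rw [List.cons_append, List.cons.injEq] at h
          obtain ⟨rfl, rfl⟩ := h
          exact ⟨k₁, d ++ a :: l₂, .inl (by simp)⟩

section

variable {R : Type*} [LinearOrder R] {A : SimpleGraph V} {rank : A.ConnectedComponent → R}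

/-- Removing a visit of a component of smallest rank preserves unguardedness. -/
theorem Unguarded.remove (hinj : Function.Injective rank) {l₁ l₂ : List (V × V)} {a : V × V}
    (h : Unguarded A rank (l₁ ++ a :: l₂))
    (hmin : ∀ s ∈ l₁ ++ a :: l₂, rank (stopComp A a) ≤ rank (stopComp A s)) :
    Unguarded A rank (l₁ ++ l₂) := by
  intro k₁ s m t k₂ heq hst
  obtain ⟨k₁', k₂', h' | ⟨m₁, m₂, rfl, h'⟩⟩ := exists_append_of_append_eq a heq
  · exact h _ _ _ _ _ h' hst
  · obtain ⟨r, hr, hsr⟩ := h _ _ _ _ _ h' hst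
    rw [List.mem_append, List.mem_cons] at hr
    rcases hr with hr | rfl | hr
    · exact ⟨r, by simp [hr], hsr⟩
    · -- the removed visit is one of the same component, so one can look left of it
      have hs : stopComp A s = stopComp A r :=
        hinj (le_antisymm hsr (hmin s (by simp [h'])))
      obtain ⟨q, hq, hsq⟩ := h k₁' s m₁ r (m₂ ++ t :: k₂') (by simp [h']) hs
      exact ⟨q, by simp [hq], hsq⟩
    · exact ⟨r, by simp [hr], hsr⟩

theorem Unguarded.stopComp_ne {l₁ l₂ : List (V × V)} {s t : V × V}
    (h : Unguarded A rank (l₁ ++ s :: t :: l₂)) : stopComp A s ≠ stopComp A t := by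
  intro hst
  obtain ⟨r, hr, -⟩ := h l₁ s [] t l₂ (by simp) hst
  simp at hr

/-- The edges of an unguarded sequence of stops gain the weights of all its visits but one. The
proof removes the visits by increasing rank. -/
theorem Unguarded.chargeable (hinj : Function.Injective rank) {w : A.ConnectedComponent → ℝ}
    (hw : ∀ C, 0 ≤ w C) (hrank : ∀ C D, rank C ≤ rank D → w C ≤ w D) {W t : ℝ} :
    ∀ (n : ℕ) (l : List (V × V)), l.length = n + 1 → (∀ s ∈ l, A.Reachable s.1 s.2) →
      Unguarded A rank l → (∀ s ∈ l, w (stopComp A s) ≤ W) → (∀ s ∈ l, t ≤ w (stopComp A s)) →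
      Chargeable A w t (stopEdges l) ((l.map fun s => w (stopComp A s)).sum - W) := by
  classical
  intro n
  induction n generalizing t with
  | zero =>
    intro l hl _ _ hW _
    obtain ⟨s, rfl⟩ := List.length_eq_one_iff.1 hl
    exact .piece _ ∅ 0 _ (by simp) le_rfl (by simp) (by simp) (by simpa using hW)
  | succ n ih =>
    intro l hl hAl hun hW ht
    obtain ⟨a, ha, hmin⟩ := l.toFinset.exists_min_image (fun s => rank (stopComp A s))
      (by rw [List.toFinset_nonempty_iff]; rintro rfl; simp at hl)
    simp only [List.mem_toFinset] at ha hmin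
    obtain ⟨l₁, l₂, rfl⟩ := List.append_of_mem ha
    set C := stopComp A a with hC
    have hfst : ∀ s : V × V, A.connectedComponentMk s.1 = stopComp A s := fun _ => rfl
    have hsnd : ∀ s ∈ l₁ ++ a :: l₂, A.connectedComponentMk s.2 = stopComp A s := fun s hs =>
      SimpleGraph.ConnectedComponent.sound (hAl s hs).symm
    have hwmin : ∀ s ∈ l₁ ++ a :: l₂, w C ≤ w (stopComp A s) := fun s hs => hrank _ _ (hmin s hs)
    have hsub : ∀ s ∈ l₁ ++ l₂, s ∈ l₁ ++ a :: l₂ := fun s hs => by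
      simp only [List.mem_append, List.mem_cons] at hs ⊢
      tauto
    refine Chargeable.mono (ht a ha) ?_
    have hIH : Chargeable A w (w C) (stopEdges (l₁ ++ l₂))
        (((l₁ ++ l₂).map fun s => w (stopComp A s)).sum - W) :=
      ih (l₁ ++ l₂) (by simp at hl ⊢; omega) (fun s hs => hAl s (hsub s hs))
        (hun.remove hinj hmin) (fun s hs => hW s (hsub s hs)) (fun s hs => hwmin s (hsub s hs))
    have hsum : ((l₁ ++ a :: l₂).map fun s => w (stopComp A s)).sum - W
        = ((l₁ ++ l₂).map fun s => w (stopComp A s)).sum - W + w C := by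
      simp only [List.map_append, List.map_cons, List.sum_append, List.sum_cons, hC]
      ring
    rw [hsum]
    rcases l₁.eq_nil_or_concat with rfl | ⟨l₁, b, rfl⟩
    · rcases l₂ with - | ⟨c, l₂⟩
      · simp at hl
      · have hne : C ≠ stopComp A c := Unguarded.stopComp_ne (l₁ := []) hun
        have h1 : Chargeable A w (w C) {(a.2, c.1)} (w C) := by
          have h := Chargeable.single hw (hsnd a ha) (hfst c) hne
          rwa [min_eq_left (hwmin c (by simp))] at h
        have := Chargeable.add _ _ _ _ hIH h1
        rwa [add_comm (Multiset.ofList _), Multiset.singleton_add] at this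
    · simp only [List.concat_eq_append, List.append_assoc, List.singleton_append] at *
      have hb : b ∈ l₁ ++ b :: a :: l₂ := by simp
      have hne : stopComp A b ≠ C := hun.stopComp_ne
      rcases l₂ with - | ⟨c, l₂⟩
      · have h1 : Chargeable A w (w C) {(b.2, a.1)} (w C) := by
          have h := Chargeable.single hw (hsnd b hb) (hfst a) hne
          rwa [min_eq_right (hwmin b hb)] at h
        have := Chargeable.add _ _ _ _ hIH h1
        rw [stopEdges_append_cons, stopEdges_cons_cons, stopEdges_singleton, ← Multiset.coe_add]
        exact this
      · have hne' : stopComp A c ≠ C :=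
          (Unguarded.stopComp_ne (l₁ := l₁ ++ [b]) (by simpa using hun)).symm
        have h1 := Chargeable.subdivide hw (b := b.2) (c := c.1) (hfst a) (hsnd a ha)
          (by rwa [hsnd b hb]) (by rw [hsnd b hb]; exact hwmin b hb)
          hne' (hwmin c (by simp)) hIH (stopEdges (l₁ ++ [b]) ++ stopEdges (c :: l₂) : List (V × V))
          (by
            rw [stopEdges_append_cons, stopEdges_cons_cons, Multiset.cons_coe, Multiset.coe_eq_coe]
            exact List.perm_middle)
        convert h1 using 1
        rw [stopEdges_append_cons, stopEdges_cons_cons, stopEdges_cons_cons, Multiset.cons_coe,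
          Multiset.cons_coe, Multiset.coe_eq_coe]
        exact List.perm_middle.trans (List.perm_middle.cons _)

end

/-- Total length of the edges traversed by a sequence of stops. -/
noncomputable def stopLength [PseudoMetricSpace V] (l : List (V × V)) : ℝ :=
  contractedLength (stopEdges l)

section metric

variable [PseudoMetricSpace V]

theorem stopLength_append_cons (l₁ : List (V × V)) (s : V × V) (l₂ : List (V × V)) :
    stopLength (l₁ ++ s :: l₂) = stopLength (l₁ ++ [s]) + stopLength (s :: l₂) := by
  rw [stopLength, stopEdges_append_cons]
  simp [stopLength, contractedLength]

theorem stopLength_nonneg (l : List (V × V)) : 0 ≤ stopLength l := contractedLength_nonneg _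

/-- Only the exit of the first stop matters for the length. -/
theorem stopLength_cons_congr {s s' : V × V} (h : s.2 = s'.2) (l : List (V × V)) :
    stopLength (s :: l) = stopLength (s' :: l) := by
  cases l <;> simp [stopLength, h]

/-- Only the entry of the last stop matters for the length. -/
theorem stopLength_append_singleton_congr {s s' : V × V} (h : s.1 = s'.1) (l : List (V × V)) :
    stopLength (l ++ [s]) = stopLength (l ++ [s']) := by
  induction l with
  | nil => rfl
  | cons a l ih =>
    cases l with
    | nil => simp [stopLength, h]
    | cons b l => simpa [stopLength, contractedLength] using ih

theorem stopLength_reverse (l : List (V × V)) :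
    stopLength (l.map Prod.swap).reverse = stopLength l := by
  induction l with
  | nil => rfl
  | cons a l ih =>
    cases l with
    | nil => rfl
    | cons b l =>
      rw [List.map_cons, List.map_cons, List.reverse_cons, List.reverse_cons, List.append_assoc,
        List.singleton_append, stopLength_append_cons, ← List.reverse_cons, ← List.map_cons, ih]
      simp [stopLength, contractedLength, dist_comm b.1, add_comm]

/-- An excursion that leaves a component of `A` at `s.2` and returns to it at `t.1` is at least as
long as a shortest contracted path. -/
theorem contractedDist_le_stopLength {A : SimpleGraph V} {s t : V × V}
    (hst : A.Reachable s.2 t.1) {m : List (V × V)} (hm : ∀ r ∈ m, A.Reachable r.1 r.2)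
    (hm' : ∀ r ∈ m, ¬ A.Reachable s.2 r.1) :
    contractedDist A s.2 t.1 ≤ stopLength (s :: m ++ [t]) := by
  set u := s.2 with hu
  have key : ∀ (m : List (V × V)) (s e : V × V), Shrunk A u e.2 s.2 →
      (A.Reachable u s.2 → s.2 = u) →
      (∀ r ∈ m, A.Reachable r.1 r.2) → (∀ r ∈ m, ¬ A.Reachable u r.1) →
      List.IsChain (fun e e' : V × V => Shrunk A u e.2 e'.1) (e :: stopEdges (s :: m ++ [t])) ∧
      ((e :: stopEdges (s :: m ++ [t])).getLast (List.cons_ne_nil _ _)).2 = t.1 ∧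
      ∀ f ∈ stopEdges (s :: m ++ [t]),
        (A.Reachable u f.1 → f.1 = u) ∧ (A.Reachable u f.2 → f.2 = t.1) := by
    intro m
    induction m with
    | nil =>
      intro s e hes hs _ _
      simpa using ⟨hes, hs⟩
    | cons r m ih =>
      intro s e hes hs hm hm'
      have hr := hm r (by simp)
      have hr' := hm' r (by simp)
      obtain ⟨h1, h2, h3⟩ := ih r (s.2, r.1) (.inr ⟨hr, hr'⟩)
        (fun h => absurd (h.trans hr.symm) hr') (fun q hq => hm q (by simp [hq]))
        (fun q hq => hm' q (by simp [hq]))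
      rw [List.cons_append, List.cons_append, stopEdges_cons_cons, ← List.cons_append]
      refine ⟨List.isChain_cons_cons.2 ⟨hes, h1⟩, by rwa [List.getLast_cons_cons], ?_⟩
      intro f hf
      rcases List.mem_cons.1 hf with rfl | hf
      · exact ⟨hs, fun h => absurd h hr'⟩
      · exact h3 f hf
  obtain ⟨h1, h2, h3⟩ := key m s (u, u) (Shrunk.refl A u u) (fun _ => rfl) hm hm'
  exact contractedDist_le_of_walk hst h1 h2 h3

theorem contractedEdgeLength_le_stopLength {A : SimpleGraph V} {s t : V × V}
    (hst : A.Reachable s.2 t.1) {m : List (V × V)} (hm : ∀ r ∈ m, A.Reachable r.1 r.2)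
    (hm' : ∀ r ∈ m, ¬ A.Reachable s.2 r.1) :
    contractedEdgeLength A s(s.2, t.1) ≤ stopLength (s :: m ++ [t]) := by
  rw [contractedEdgeLength_mk]
  split_ifs
  · refine max_le (contractedDist_le_stopLength hst hm hm') ?_
    have := contractedDist_le_stopLength (s := t.swap) (t := s.swap) (A := A)
      (m := (m.map Prod.swap).reverse) hst.symm ?_ ?_
    · rw [← stopLength_reverse (s :: m ++ [t])]
      simpa using this
    · intro r hr
      rw [List.mem_reverse, List.mem_map] at hr
      obtain ⟨q, hq, rfl⟩ := hr
      exact (hm q hq).symm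
    · intro r hr
      rw [List.mem_reverse, List.mem_map] at hr
      obtain ⟨q, hq, rfl⟩ := hr
      exact fun h => hm' q hq ((hst.trans h).trans (hm q hq).symm)
  · exact stopLength_nonneg _

end metric

end

section

variable {V : Type*}

/-! ### Discharging stops -/

/-- The part `B` of the solution built so far joins each pair of `Q`, or it links both vertices of
the pair to stops of `l`, which are still to be processed. -/
def Linked (Q : Finset (V × V)) (B : SimpleGraph V) (l : List (V × V)) : Prop :=
  ∀ p ∈ Q, B.Reachable p.1 p.2 ∨
    (∃ r ∈ l, B.Reachable p.1 r.1) ∧ ∃ r ∈ l, B.Reachable p.2 r.1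

theorem Linked.mono {Q : Finset (V × V)} {B B' : SimpleGraph V} {l l' : List (V × V)}
    (h : Linked Q B l) (hB : B ≤ B') (hl : ∀ r ∈ l, ∃ r' ∈ l', B'.Reachable r.1 r'.1) :
    Linked Q B' l' := by
  have key : ∀ v, (∃ r ∈ l, B.Reachable v r.1) → ∃ r ∈ l', B'.Reachable v r.1 := by
    rintro v ⟨r, hr, hvr⟩
    obtain ⟨r', hr', hrr'⟩ := hl r hr
    exact ⟨r', hr', (hvr.mono hB).trans hrr'⟩
  exact fun p hp => (h p hp).imp (fun h => h.mono hB) (And.imp (key _) (key _))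

theorem Linked.feasible_nil {Q : Finset (V × V)} {B : SimpleGraph V} (h : Linked Q B []) :
    Feasible Q B := fun p hp => (h p hp).elim id (by simp)

theorem Linked.feasible_singleton {Q : Finset (V × V)} {B : SimpleGraph V} {s : V × V}
    (h : Linked Q B [s]) : Feasible Q B := by
  intro p hp
  rcases h p hp with h | ⟨h1, h2⟩
  · exact h
  · simp only [List.mem_singleton, exists_eq_left] at h1 h2
    exact h1.trans h2.symm

section metric

variable [Fintype V] [PseudoMetricSpace V] {P Q : Finset (V × V)} {A : SimpleGraph V}
  {len : Sym2 V → ℝ}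

theorem dist_le_width {p : V × V} (hp : p ∈ P) {C : A.ConnectedComponent}
    (h1 : A.connectedComponentMk p.1 = C) (h2 : A.connectedComponentMk p.2 = C) :
    dist p.1 p.2 ≤ width P C := by
  classical
  rw [← coe_nndist, NNReal.coe_le_coe, width]
  exact Finset.le_sup (f := fun p : V × V => nndist p.1 p.2) (Finset.mem_filter.2 ⟨hp, h1, h2⟩)

/-- A stop can be dropped at the cost of the width of its component: if some pair is still separated
and has a vertex linked to the stop, then joining this pair links the stop to another one. -/
theorem Linked.discharge (hlen : ∀ e, 0 ≤ len e) (hlen' : ∀ e, len e ≤ edgeLength e)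
    (hA : Feasible P A) (hQ : Q ⊆ P) {B : SimpleGraph V} (hB : ∀ u v, B.Adj u v → A.Reachable u v)
    {s : V × V} {l l' : List (V × V)} (h : Linked Q B l) (hl : ∀ r ∈ l, r = s ∨ r ∈ l') :
    ∃ B', (∀ u v, B'.Adj u v → A.Reachable u v) ∧ B ≤ B' ∧ Linked Q B' l' ∧
      cost len B' ≤ cost len B + width P (stopComp A s) := by
  by_cases hex : ∃ p ∈ Q, ¬ B.Reachable p.1 p.2 ∧ (B.Reachable p.1 s.1 ∨ B.Reachable p.2 s.1)
  · obtain ⟨p, hp, hsep, hps⟩ := hex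
    have hpA := hA p (hQ hp)
    have hpe : (B ⊔ SimpleGraph.edge p.1 p.2).Reachable p.1 p.2 :=
      (edge_reachable _ _).mono le_sup_right
    refine ⟨B ⊔ SimpleGraph.edge p.1 p.2, ?_, le_sup_left, ?_, ?_⟩
    · intro a b hab
      rw [SimpleGraph.sup_adj, SimpleGraph.edge_adj] at hab
      rcases hab with hab | ⟨⟨rfl, rfl⟩ | ⟨rfl, rfl⟩, -⟩
      · exact hB a b hab
      · exact hpA
      · exact hpA.symm
    · -- the other vertex of `p` is linked to a stop other than `s`
      have hs : ∃ r ∈ l', (B ⊔ SimpleGraph.edge p.1 p.2).Reachable s.1 r.1 := by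
        obtain ⟨⟨q, hq, hpq⟩, r, hr, hpr⟩ := (h p hp).resolve_left hsep
        rcases hps with hps | hps
        · rcases hl r hr with rfl | hr
          · exact absurd (hps.trans hpr.symm) hsep
          · exact ⟨r, hr, ((hps.mono le_sup_left).symm.trans hpe).trans (hpr.mono le_sup_left)⟩
        · rcases hl q hq with rfl | hq
          · exact absurd (hpq.trans hps.symm) hsep
          · exact ⟨q, hq, ((hps.mono le_sup_left).symm.trans hpe.symm).trans
              (hpq.mono le_sup_left)⟩
      refine h.mono le_sup_left fun r hr => ?_
      rcases hl r hr with rfl | hr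
      · exact hs
      · exact ⟨r, hr, .rfl⟩
    · refine (cost_sup_le hlen _ _).trans (add_le_add_right ?_ _)
      refine ((cost_edge_le hlen _ _).trans (hlen' _)).trans ?_
      have hBA : ∀ a b, B.Reachable a b → A.Reachable a b := fun a b =>
        reachable_of_forall_adj hB
      have h1 : A.Reachable p.1 s.1 := hps.elim (hBA _ _) fun h => hpA.trans (hBA _ _ h)
      exact dist_le_width (hQ hp) (SimpleGraph.ConnectedComponent.sound h1)
        (SimpleGraph.ConnectedComponent.sound (hpA.symm.trans h1))
  · push Not at hex
    refine ⟨B, hB, le_rfl, fun p hp => ?_, le_add_of_nonneg_right (NNReal.coe_nonneg _)⟩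
    by_cases hsep : B.Reachable p.1 p.2
    · exact .inl hsep
    · obtain ⟨⟨q, hq, hpq⟩, r, hr, hpr⟩ := (h p hp).resolve_left hsep
      obtain ⟨h1, h2⟩ := hex p hp hsep
      refine .inr ⟨⟨q, (hl q hq).resolve_left ?_, hpq⟩, r, (hl r hr).resolve_left ?_, hpr⟩
      · rintro rfl
        exact h1 hpq
      · rintro rfl
        exact h2 hpr

theorem Linked.discharge_list (hlen : ∀ e, 0 ≤ len e) (hlen' : ∀ e, len e ≤ edgeLength e)
    (hA : Feasible P A) (hQ : Q ⊆ P) {l' : List (V × V)} (m : List (V × V)) :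
    ∀ (B : SimpleGraph V) (l : List (V × V)), (∀ u v, B.Adj u v → A.Reachable u v) →
      Linked Q B l → (∀ r ∈ l, r ∈ m ∨ r ∈ l') →
      ∃ B', (∀ u v, B'.Adj u v → A.Reachable u v) ∧ B ≤ B' ∧ Linked Q B' l' ∧
        cost len B' ≤ cost len B + (m.map fun s => (width P (stopComp A s) : ℝ)).sum := by
  induction m with
  | nil =>
    intro B l hB h hl
    exact ⟨B, hB, le_rfl, h.mono le_rfl fun r hr => ⟨r, by simpa using hl r hr, .rfl⟩, by simp⟩
  | cons s m ih =>
    intro B l hB h hl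
    obtain ⟨B₁, hB₁, hle₁, hlink₁, hcost₁⟩ := h.discharge hlen hlen' hA hQ hB (s := s)
      (l' := m ++ l') fun r hr => by simpa [or_assoc] using hl r hr
    obtain ⟨B₂, hB₂, hle₂, hlink₂, hcost₂⟩ := ih B₁ _ hB₁ hlink₁ fun r hr => by simpa using hr
    refine ⟨B₂, hB₂, hle₁.trans hle₂, hlink₂, ?_⟩
    rw [List.map_cons, List.sum_cons]
    linarith

/-! ### Replacing a tour by edges inside the components -/

/-- The components of `A`, linearly ordered by their widths, with ties broken arbitrarily. -/
noncomputable def compRank (P : Finset (V × V)) (A : SimpleGraph V) (C : A.ConnectedComponent) :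
    ℝ≥0 ×ₗ Fin (Nat.card A.ConnectedComponent) :=
  toLex (width P C, Finite.equivFin _ C)

theorem compRank_injective (P : Finset (V × V)) (A : SimpleGraph V) :
    Function.Injective (compRank P A) := fun C D h => by
  have := congrArg Prod.snd (toLex.injective h)
  exact (Finite.equivFin _).injective this

theorem width_le_of_compRank_le {C D : A.ConnectedComponent} (h : compRank P A C ≤ compRank P A D) :
    (width P C : ℝ) ≤ width P D := by
  rw [compRank, compRank, Prod.Lex.toLex_le_toLex] at h
  rcases h with h | h
  · exact_mod_cast h.le
  · exact_mod_cast h.1.le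

/-- The total width of all stops but one of an unguarded sequence is bounded by its length. -/
theorem Unguarded.sum_width_le {c : ℝ} (hc : 0 ≤ c) (hAforest : A.IsAcyclic) (hA : Feasible P A)
    (hconnect : ApproxConnectingMoveOptimal P c A) {l : List (V × V)} (hl : l ≠ [])
    (hAl : ∀ s ∈ l, A.Reachable s.1 s.2) (hun : Unguarded A (compRank P A) l) {W : ℝ}
    (hW : ∀ s ∈ l, (width P (stopComp A s) : ℝ) ≤ W) :
    (l.map fun s => (width P (stopComp A s) : ℝ)).sum - W ≤ c * stopLength l := by
  have hlen : l.length = l.length - 1 + 1 :=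
    (Nat.succ_pred_eq_of_pos (List.length_pos_of_ne_nil hl)).symm
  have := (hun.chargeable (compRank_injective P A) (w := fun C => (width P C : ℝ)) (t := 0)
    (fun C => NNReal.coe_nonneg _) (fun _ _ => width_le_of_compRank_le) _ l hlen hAl hW
    fun s _ => NNReal.coe_nonneg _).le_edgesLength hc hAforest hA hconnect
  simpa [stopLength, contractedLength, edgesLength] using this

/-- The stops of a sequence that links the pairs `Q` can be replaced by edges inside the components
of `A`, whose total length is at most `1 + c` times the length of the sequence. A guarded segment
with fewest stops is replaced by a single edge, and the stops inside it are discharged; when no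
guarded segment is left, all stops but one are discharged. -/
theorem Linked.exists_feasible {c : ℝ} (hc : 0 ≤ c) (hAforest : A.IsAcyclic) (hA : Feasible P A)
    (hconnect : ApproxConnectingMoveOptimal P c A) (hQ : Q ⊆ P) :
    ∀ (n : ℕ) (l : List (V × V)) (B : SimpleGraph V), l.length ≤ n →
      (∀ u v, B.Adj u v → A.Reachable u v) → (∀ s ∈ l, B.Reachable s.1 s.2) → Linked Q B l →
      ∃ B', (∀ u v, B'.Adj u v → A.Reachable u v) ∧ Feasible Q B' ∧
        cost (contractedEdgeLength A) B'
          ≤ cost (contractedEdgeLength A) B + (1 + c) * stopLength l := by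
  classical
  have hlen := contractedEdgeLength_nonneg A
  have hlen' := contractedEdgeLength_le A
  intro n
  induction n with
  | zero =>
    intro l B hl hB _ hlink
    obtain rfl := List.eq_nil_of_length_eq_zero (Nat.le_zero.1 hl)
    exact ⟨B, hB, hlink.feasible_nil, by simp [stopLength, contractedLength]⟩
  | succ n ih =>
    intro l B hl hB hBl hlink
    have hAl : ∀ s ∈ l, A.Reachable s.1 s.2 := fun s hs => reachable_of_forall_adj hB (hBl s hs)
    by_cases hun : Unguarded A (compRank P A) l
    · rcases eq_or_ne l [] with rfl | hne
      · exact ⟨B, hB, hlink.feasible_nil, by simp [stopLength, contractedLength]⟩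
      -- discharge all stops but one of largest width
      obtain ⟨z, hz, hmax⟩ := l.toFinset.exists_max_image
        (fun s => (width P (stopComp A s) : ℝ)) (by rwa [List.toFinset_nonempty_iff])
      simp only [List.mem_toFinset] at hz hmax
      have hsum := hun.sum_width_le hc hAforest hA hconnect hne hAl hmax
      obtain ⟨l₁, l₂, rfl⟩ := List.append_of_mem hz
      obtain ⟨B', hB', -, hlink', hcost⟩ := hlink.discharge_list hlen hlen' hA hQ (l' := [z])
        (l₁ ++ l₂) B _ hB fun r hr => by
          simp only [List.mem_append, List.mem_cons, List.not_mem_nil, or_false] at hr ⊢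
          tauto
      refine ⟨B', hB', hlink'.feasible_singleton, hcost.trans ?_⟩
      have h0 := stopLength_nonneg (l₁ ++ z :: l₂)
      simp only [List.map_append, List.map_cons, List.sum_append, List.sum_cons] at hsum ⊢
      linarith
    · -- a guarded segment `s, m, t` with fewest stops; then `s, m` is unguarded
      have hex : ∃ k, ∃ l₁ s m t l₂, m.length = k ∧ l = l₁ ++ s :: m ++ t :: l₂ ∧
          stopComp A s = stopComp A t ∧
          ∀ r ∈ m, compRank P A (stopComp A r) < compRank P A (stopComp A s) := by
        rw [Unguarded] at hun
        push Not at hun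
        obtain ⟨l₁, s, m, t, l₂, h1, h2, h3⟩ := hun
        exact ⟨_, l₁, s, m, t, l₂, rfl, h1, h2, h3⟩
      obtain ⟨l₁, s, m, t, l₂, hmk, rfl, hst, hm⟩ := Nat.find_spec hex
      have hmin : ∀ l₁' s' m' t' l₂', m'.length < m.length →
          l₁ ++ s :: m ++ t :: l₂ = l₁' ++ s' :: m' ++ t' :: l₂' → stopComp A s' = stopComp A t' →
          ∃ r ∈ m', compRank P A (stopComp A s') ≤ compRank P A (stopComp A r) := by
        intro l₁' s' m' t' l₂' hlt heq hst'
        by_contra! hm'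
        exact Nat.find_min hex (hmk ▸ hlt) ⟨l₁', s', m', t', l₂', rfl, heq, hst', hm'⟩
      have hunm : Unguarded A (compRank P A) (s :: m) := by
        intro k₁ s' m' t' k₂ heq hst'
        refine hmin (l₁ ++ k₁) s' m' t' (k₂ ++ t :: l₂) ?_ ?_ hst'
        · have := congrArg List.length heq
          simp only [List.length_cons, List.length_append] at this
          omega
        · rw [List.append_assoc, heq]
          simp
      have hs : s ∈ l₁ ++ s :: m ++ t :: l₂ := by simp
      have ht : t ∈ l₁ ++ s :: m ++ t :: l₂ := by simp
      have hm_mem : ∀ r ∈ m, r ∈ l₁ ++ s :: m ++ t :: l₂ := fun r hr => by simp [hr]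
      -- the edge that replaces the segment
      have hAst : A.Reachable s.2 t.1 :=
        (hAl s hs).symm.trans (SimpleGraph.ConnectedComponent.exact hst)
      have hedge : contractedEdgeLength A s(s.2, t.1) ≤ stopLength (s :: m ++ [t]) := by
        refine contractedEdgeLength_le_stopLength hAst (fun r hr => hAl r (hm_mem r hr)) ?_
        intro r hr hsr
        refine (hm r hr).ne (congrArg _ ?_)
        exact SimpleGraph.ConnectedComponent.sound ((hAl s hs).trans hsr).symm
      -- the widths of the stops inside the segment
      have hwidth : (m.map fun r => (width P (stopComp A r) : ℝ)).sum
          ≤ c * stopLength (s :: m ++ [t]) := by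
        have h1 := hunm.sum_width_le hc hAforest hA hconnect (by simp)
          (by
            intro r hr
            rcases List.mem_cons.1 hr with rfl | hr
            · exact hAl _ hs
            · exact hAl r (hm_mem r hr))
          (W := width P (stopComp A s))
          (by
            intro r hr
            rcases List.mem_cons.1 hr with rfl | hr
            · exact le_rfl
            · exact width_le_of_compRank_le (hm r hr).le)
        have h2 : stopLength (s :: m) ≤ stopLength (s :: m ++ [t]) := by
          obtain ⟨k, x, hkx⟩ := (s :: m).eq_nil_or_concat.resolve_left (by simp)
          rw [hkx, List.concat_eq_append, List.append_assoc, List.singleton_append,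
            stopLength_append_cons k x [t]]
          exact le_add_of_nonneg_right (stopLength_nonneg _)
        rw [List.map_cons, List.sum_cons, add_sub_cancel_left] at h1
        exact h1.trans (mul_le_mul_of_nonneg_left h2 hc)
      obtain ⟨B₁, hB₁, hle₁, hlink₁, hcost₁⟩ := hlink.discharge_list hlen hlen' hA hQ
        (l' := l₁ ++ s :: t :: l₂) m B _ hB fun r hr => by
          simp only [List.mem_append, List.mem_cons] at hr ⊢
          tauto
      set B₂ := B₁ ⊔ SimpleGraph.edge s.2 t.1 with hB₂
      have hle₂ : B₁ ≤ B₂ := le_sup_left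
      have hB₂A : ∀ u v, B₂.Adj u v → A.Reachable u v := by
        intro u v huv
        rw [hB₂, SimpleGraph.sup_adj, SimpleGraph.edge_adj] at huv
        rcases huv with huv | ⟨⟨rfl, rfl⟩ | ⟨rfl, rfl⟩, -⟩
        · exact hB₁ u v huv
        · exact hAst
        · exact hAst.symm
      have hst₂ : B₂.Reachable s.1 t.1 := ((hBl s hs).mono (hle₁.trans hle₂)).trans
        ((edge_reachable _ _).mono le_sup_right)
      obtain ⟨B', hB', hfeas, hcost⟩ := ih (l₁ ++ (s.1, t.2) :: l₂) B₂
        (by simp at hl ⊢; omega) hB₂A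
        (by
          intro r hr
          rw [List.mem_append, List.mem_cons] at hr
          rcases hr with hr | rfl | hr
          · exact (hBl r (by simp [hr])).mono (hle₁.trans hle₂)
          · exact hst₂.trans ((hBl t ht).mono (hle₁.trans hle₂))
          · exact (hBl r (by simp [hr])).mono (hle₁.trans hle₂))
        (by
          refine hlink₁.mono hle₂ fun r hr => ?_
          rw [List.mem_append, List.mem_cons, List.mem_cons] at hr
          rcases hr with hr | rfl | rfl | hr
          · exact ⟨r, by simp [hr], .rfl⟩
          · exact ⟨(r.1, t.2), by simp, .rfl⟩
          · exact ⟨(s.1, r.2), by simp, hst₂.symm⟩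
          · exact ⟨r, by simp [hr], .rfl⟩)
      refine ⟨B', hB', hfeas, hcost.trans ?_⟩
      have hcost₂ : cost (contractedEdgeLength A) B₂
          ≤ cost (contractedEdgeLength A) B₁ + contractedEdgeLength A s(s.2, t.1) :=
        (cost_sup_le hlen _ _).trans (add_le_add_right (cost_edge_le hlen _ _) _)
      have hlenl : stopLength (l₁ ++ s :: m ++ t :: l₂)
          = stopLength (l₁ ++ (s.1, t.2) :: l₂) + stopLength (s :: m ++ [t]) := by
        have h1 := stopLength_append_cons l₁ s (m ++ t :: l₂)
        have h2 := stopLength_append_cons (s :: m) t l₂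
        have h3 := stopLength_append_cons l₁ (s.1, t.2) l₂
        rw [stopLength_append_singleton_congr (s := (s.1, t.2)) (s' := s) rfl,
          stopLength_cons_congr (s := (s.1, t.2)) (s' := t) rfl] at h3
        rw [List.append_assoc, List.cons_append, h1, ← List.cons_append, h2, h3]
        ring
      rw [hlenl]
      linarith

end metric

/-! ### Tours of the components of a graph -/

/-- The subgraph formed by the edges of `F` in the component of `r`. -/
def compGraph (F : SimpleGraph V) (r : V) : SimpleGraph V where
  Adj a b := F.Adj a b ∧ F.Reachable r a
  symm := ⟨fun _ _ h => ⟨h.1.symm, h.2.trans h.1.reachable⟩⟩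
  loopless := ⟨fun _ h => h.1.ne rfl⟩

variable [Fintype V]

theorem sum_cost_compGraph_le (F : SimpleGraph V) [Fintype F.ConnectedComponent]
    {r : F.ConnectedComponent → V} (hr : ∀ X, F.connectedComponentMk (r X) = X)
    (len : Sym2 V → ℝ) :
    ∑ X, cost len (compGraph F (r X)) ≤ cost len F := by
  classical
  simp only [cost_eq_sum_ite]
  rw [Finset.sum_comm]
  refine Finset.sum_le_sum fun e _ => ?_
  induction e with | _ a b =>
  by_cases hab : F.Adj a b
  · have : ∀ X, s(a, b) ∈ (compGraph F (r X)).edgeSet ↔ X = F.connectedComponentMk a := fun X => by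
      rw [SimpleGraph.mem_edgeSet]
      refine ⟨fun h => ?_, fun h => ⟨hab, ?_⟩⟩
      · rw [← hr X]
        exact SimpleGraph.ConnectedComponent.sound h.2
      · exact SimpleGraph.ConnectedComponent.exact ((hr X).trans h)
    simp [this, hab]
  · have : ∀ X, s(a, b) ∉ (compGraph F (r X)).edgeSet := fun X h => hab h.1
    simp [this, hab]

variable [PseudoMetricSpace V]

/-- Every component has a closed tour that uses each of its edges at most twice. -/
theorem exists_tour (F : SimpleGraph V) : ∀ r, ∃ L : List V,
    (∀ v, F.Reachable r v → v ∈ r :: L) ∧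
      stopLength ((r :: L ++ [r]).map fun v => (v, v)) ≤ 2 * cost edgeLength (compGraph F r) := by
  induction F using WellFoundedLT.induction with | _ F ih =>
  intro r
  by_cases hx : ∃ x, F.Adj r x
  · obtain ⟨x, hx⟩ := hx
    set F₀ := F.deleteEdges {s(r, x)} with hF₀
    have hle : F₀ ≤ F := SimpleGraph.deleteEdges_le _
    have hnadj : ¬ F₀.Adj r x := by simp [hF₀]
    have hlt : F₀ < F := lt_of_le_not_ge hle fun h => hnadj (h hx)
    have hsup : F ≤ F₀ ⊔ SimpleGraph.edge r x := by
      intro a b hab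
      by_cases heq : s(a, b) = s(r, x)
      · exact .inr (by simpa [SimpleGraph.edge_adj, hab.ne] using heq)
      · exact .inl (SimpleGraph.deleteEdges_adj.2 ⟨hab, heq⟩)
    have hsplit : ∀ v, F.Reachable r v → F₀.Reachable r v ∨ F₀.Reachable x v := by
      intro v hv
      rcases reachable_or_of_reachable_sup_edge (hv.symm.mono hsup) with h | h | h
      · exact .inl h.symm
      · exact .inl h.symm
      · exact .inr h.symm
    have hmono : compGraph F₀ r ≤ compGraph F r := fun a b h => ⟨hle h.1, h.2.mono hle⟩
    obtain ⟨L₁, hL₁, hlen₁⟩ := ih F₀ hlt r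
    by_cases hrx : F₀.Reachable r x
    · refine ⟨L₁, fun v hv => hL₁ v ?_, hlen₁.trans ?_⟩
      · exact (hsplit v hv).elim id hrx.trans
      · exact mul_le_mul_of_nonneg_left (cost_mono edgeLength_nonneg hmono) zero_le_two
    · obtain ⟨L₂, hL₂, hlen₂⟩ := ih F₀ hlt x
      refine ⟨L₁ ++ r :: x :: L₂ ++ [x], fun v hv => ?_, ?_⟩
      · have h1 := hL₁ v
        have h2 := hL₂ v
        simp only [List.mem_cons, List.mem_append] at h1 h2 ⊢
        rcases hsplit v hv with h | h
        · have := h1 h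
          tauto
        · have := h2 h
          tauto
      · have hdisj : Disjoint (compGraph F₀ r) (compGraph F₀ x) := by
          rw [disjoint_iff_inf_le]
          exact fun a b h => hrx (h.1.2.trans h.2.2.symm)
        have hdisj' : Disjoint (compGraph F₀ r ⊔ compGraph F₀ x) (SimpleGraph.edge r x) := by
          refine Disjoint.mono_left (b := F₀) (sup_le (fun _ _ h => h.1) fun _ _ h => h.1) ?_
          rw [disjoint_iff_inf_le]
          rintro a b ⟨h, h'⟩
          rcases ((SimpleGraph.edge_adj ..).1 h').1 with ⟨rfl, rfl⟩ | ⟨rfl, rfl⟩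
          · exact hnadj h
          · exact hnadj h.symm
        have hcost : cost edgeLength (compGraph F₀ r) + cost edgeLength (compGraph F₀ x)
            + dist r x ≤ cost edgeLength (compGraph F r) := by
          rw [← edgeLength_mk, ← cost_edge (len := edgeLength) hx.ne, ← cost_sup_of_disjoint hdisj,
            ← cost_sup_of_disjoint hdisj']
          refine cost_mono edgeLength_nonneg (sup_le (sup_le hmono fun a b h => ?_) fun a b h => ?_)
          · exact ⟨hle h.1, hx.reachable.trans (h.2.mono hle)⟩
          · rcases ((SimpleGraph.edge_adj ..).1 h).1 with ⟨rfl, rfl⟩ | ⟨rfl, rfl⟩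
            · exact ⟨hx, .rfl⟩
            · exact ⟨hx.symm, hx.reachable⟩
        have hlen : stopLength ((r :: (L₁ ++ r :: x :: L₂ ++ [x]) ++ [r]).map fun v => (v, v))
            = stopLength ((r :: L₁ ++ [r]).map fun v => (v, v))
              + (dist r x + (stopLength ((x :: L₂ ++ [x]).map fun v => (v, v)) + dist x r)) := by
          have h1 := stopLength_append_cons ((r :: L₁).map fun v => (v, v)) (r, r)
            ((x :: L₂ ++ [x, r]).map fun v => (v, v))
          have h2 := stopLength_append_cons ((x :: L₂).map fun v => (v, v)) (x, x) [(r, r)]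
          simp only [List.map_append, List.map_cons, List.map_nil, List.cons_append,
            List.append_assoc, List.nil_append] at h1 h2 ⊢
          rw [h1]
          simp only [stopLength, stopEdges_cons_cons, stopEdges_singleton, contractedLength,
            List.map_cons, List.map_nil, List.sum_cons, List.sum_nil, add_zero] at h2 ⊢
          rw [h2]
        rw [hlen, dist_comm x r]
        linarith
  · refine ⟨[], fun v hv => ?_, ?_⟩
    · obtain ⟨p⟩ := hv
      cases p with
      | nil => simp
      | cons h _ => exact absurd ⟨_, h⟩ hx
    · simpa [stopLength, contractedLength] using cost_nonneg edgeLength_nonneg _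

end

end SteinerForest

theorem mainTheorem3 {V : Type*} [Fintype V] [PseudoMetricSpace V]
    (P : Finset (V × V)) (A F : SimpleGraph V) (c : ℝ) (hc : 1 ≤ c)
    (hAforest : A.IsAcyclic)
    (hA : SteinerForest.Feasible P A)
    (hF : SteinerForest.Feasible P F)
    (hterminal : ∀ u v : V, A.Adj u v →
      SteinerForest.IsTerminal P u ∧ SteinerForest.IsTerminal P v)
    (hEdgeEdge : SteinerForest.EdgeEdgeSwapOptimal P A ⊤ SteinerForest.edgeLength)
    (hEdgeSet : SteinerForest.EdgeSetSwapOptimal P A ⊤ SteinerForest.edgeLength)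
    (hPathSet : SteinerForest.PathSetSwapOptimal P A)
    (hConnect : SteinerForest.ApproxConnectingMoveOptimal P c A) :
    ∃ (F' : SimpleGraph V) (len : Sym2 V → ℝ),
      (∀ e, 0 ≤ len e ∧ len e ≤ SteinerForest.edgeLength e) ∧
      F'.IsAcyclic ∧
      SteinerForest.Feasible P F' ∧
      SteinerForest.cost len F' ≤
        2 * (1 + c) * SteinerForest.cost SteinerForest.edgeLength F ∧
      (∀ u v : V, F'.Adj u v → A.Reachable u v) ∧
      SteinerForest.EdgeEdgeSwapOptimal P A F' len ∧
      SteinerForest.EdgeSetSwapOptimal P A F' len := by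
  classical
  open SteinerForest in
  have hc0 : 0 ≤ c := zero_le_one.trans hc
  let _ : Fintype F.ConnectedComponent := Fintype.ofFinite _
  have hlen := contractedEdgeLength_nonneg A
  choose r hr using fun X : F.ConnectedComponent => X.exists_rep
  -- for each component of `F`, the edges that replace its tour
  have hB : ∀ X : F.ConnectedComponent, ∃ B : SimpleGraph V,
      (∀ u v, B.Adj u v → A.Reachable u v) ∧
      Feasible (P.filter fun p => F.Reachable (r X) p.1) B ∧
      cost (contractedEdgeLength A) B
        ≤ 2 * (1 + c) * cost edgeLength (compGraph F (r X)) := by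
    intro X
    obtain ⟨L, hL, hLlen⟩ := exists_tour F (r X)
    have hmem : ∀ v, F.Reachable (r X) v → (v, v) ∈ (r X :: L ++ [r X]).map fun v => (v, v) :=
      fun v hv => List.mem_map.2 ⟨v, List.mem_append_left _ (hL v hv), rfl⟩
    obtain ⟨B, hBA, hfeas, hcost⟩ := Linked.exists_feasible hc0 hAforest hA hConnect
      (P.filter_subset fun p => F.Reachable (r X) p.1) _
      ((r X :: L ++ [r X]).map fun v => (v, v)) ⊥ le_rfl (by simp)
      (by
        intro s hs
        obtain ⟨v, -, rfl⟩ := List.mem_map.1 hs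
        exact .rfl)
      (by
        intro p hp
        rw [Finset.mem_filter] at hp
        exact .inr ⟨⟨_, hmem _ hp.2, .rfl⟩, _, hmem _ (hp.2.trans (hF p hp.1)), .rfl⟩)
    refine ⟨B, hBA, hfeas, ?_⟩
    rw [cost_bot, zero_add] at hcost
    have := mul_le_mul_of_nonneg_left hLlen (by linarith : 0 ≤ 1 + c)
    linarith
  choose B hBA hBfeas hBcost using hB
  obtain ⟨F', hF'le, hF'acyc, hF'reach⟩ := (⨆ X, B X).exists_isAcyclic_reachable_eq_le
  have hF'A : ∀ u v, F'.Adj u v → A.Reachable u v := by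
    intro u v huv
    obtain ⟨X, hX⟩ := SimpleGraph.iSup_adj.1 (hF'le huv)
    exact hBA X u v hX
  have hset := edgeSetSwapOptimal_contractedEdgeLength hPathSet hF'A
  refine ⟨F', contractedEdgeLength A, fun e => ⟨hlen e, contractedEdgeLength_le A e⟩, hF'acyc, ?_,
    ?_, hF'A, hset.edgeEdgeSwapOptimal hA, hset⟩
  · intro p hp
    rw [hF'reach]
    refine (hBfeas (F.connectedComponentMk p.1) p (Finset.mem_filter.2 ⟨hp, ?_⟩)).mono
      (le_iSup B _)
    exact SimpleGraph.ConnectedComponent.exact (hr _)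
  · calc cost (contractedEdgeLength A) F'
        ≤ cost (contractedEdgeLength A) (⨆ X, B X) := cost_mono hlen hF'le
      _ ≤ ∑ X, cost (contractedEdgeLength A) (B X) := cost_iSup_le hlen B
      _ ≤ ∑ X, 2 * (1 + c) * cost edgeLength (compGraph F (r X)) :=
          Finset.sum_le_sum fun X _ => hBcost X
      _ = 2 * (1 + c) * ∑ X, cost edgeLength (compGraph F (r X)) := by rw [Finset.mul_sum]
      _ ≤ 2 * (1 + c) * cost edgeLength F :=
          mul_le_mul_of_nonneg_left (sum_cost_compGraph_le F hr _) (by linarith)
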